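/- Let $M$ be a compact connected $C^\infty$ Riemannian manifold with distance $d$, let $N\subset M$ be a nonempty connected open set, let $0<\alpha\le 1$, and let $f:M\to M$ be a $C^{1+\alpha}$ diffeomorphism. **Definitions.** For a linear map $A$ write $\|A\|$ for its norm and $m(A)=\inf_{\|v\|=1}\|Av\|$ for its minimum norm, in the Riemannian norms. A $C^1$ diffeomorphism $h$ of $M$ is *pointwise hyperbolic on $N$* if $h(N)=N$ and there are a $Dh$-invariant splitting $T_xM=E^s(x)\oplus E^u(x)$ $(x\in N)$ and functions $\tau^s,\tau^u:N\to(0,\infty)$ such that for all $x\in N$ $$\|D_xh|_{E^s(x)}\|\le\tau^s(x)<1<\tau^u(x)\le m(D_xh|_{E^u(x)}).$$ In the products below, $m(Df|_{E^u(y)})$ means $m(D_yf|_{E^u(y)})$, and similarly for $f^{-1}$, $E^s$ and for norms; an infinite product equals $\infty$ if its partial products tend to $+\infty$. Let $d(x,\partial N)$ be the distance to the topological boundary of $N$ ($=\infty$ if $\partial N=\emptyset$). **Assumptions.** Let $f$ be pointwise hyperbolic on $N$ with splitting $E^s\oplus E^u$, and suppose that there are constants $r_0^t,\beta^t>0$,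 $\gamma^t>\max\{1,\beta^t/\alpha\}$, $C^t>1$ $(t=u,s)$ such that the following hold. * (U) For all $x\in N$: $\prod_{i\ge0}m(Df|_{E^u(f^ix)})=\infty=\prod_{i\ge0}m(Df|_{E^u(f^{-i}x)})$; and if $d(x,\partial N)\le r_0^u$, then $$m(Df|_{E^u(x)})-1\ \ge\ C^u\max\Big\{d(x,\partial N)^{\beta^u},\Big(\tfrac{d(f(x),\partial N)}{d(x,\partial N)}\Big)^{\gamma^u}-1\Big\}.$$ * (S) For all $x\in N$: $\prod_{i\ge0}m(Df^{-1}|_{E^s(f^ix)})=\infty=\prod_{i\ge0}m(Df^{-1}|_{E^s(f^{-i}x)})$; and if $d(x,\partial N)\le r_0^s$, then $$m(Df^{-1}|_{E^s(x)})-1\ \ge\ C^s\max\Big\{d(x,\partial N)^{\beta^s},\Big(\tfrac{d(f^{-1}(x),\partial N)}{d(x,\partial N)}\Big)^{\gamma^s}-1\Big\}.$$ * (R) $\alpha>\beta/\gamma$, where $\beta=\max\{\beta^s,\beta^u\}$ and $\gamma=\min\{\gamma^s,\gamma^u\}$. Put $r_0=\min\{r_0^u,r_0^s\}$, fix $0<\delta<\min\{1,\alpha-\beta/\gamma\}$,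 and for $\varepsilon>0$ let $$\varepsilon(x)=\varepsilon\min\{r_0^\beta,d(x,\partial N)^\beta\},\qquad Q(x)=\varepsilon^{\frac{2}{\alpha-\delta}}\min\{r_0^\gamma,d(x,\partial N)^\gamma\}.$$ * (K) There is $\varepsilon_0>0$ such that for all $0<\varepsilon\le\varepsilon_0$ and all $x\in N$ $$\frac{\|Df|_{E^s(x)}\|}{m(Df|_{E^u(x)})}<\frac{\|Df|_{E^s(x)}\|+\varepsilon\varepsilon(x)+1}{\|Df|_{E^s(f(x))}\|+\varepsilon\varepsilon(f(x))+1}\cdot\frac{m(Df|_{E^u(f(x))})-\varepsilon\varepsilon(f(x))-1}{m(Df|_{E^u(x)})-\varepsilon\varepsilon(x)-1}.$$ Since $D_xf$ and $D_xg$ take values in different tangent spaces, fix a smooth embedding $\iota:M\to\mathbb R^q$ and let $\|D_xf-D_xg\|$ denote the operator norm of $D_x(\iota\circ f)-D_x(\iota\circ g):T_xM\to\mathbb R^q$. **Theorem.** For every such $\iota$ there exist a continuous function $\xi:N\to(0,\infty)$ and $\varepsilon_1>0$ such that for every $\varepsilon\in(0,\varepsilon_1)$ and every function $\delta^u:N\to(0,\infty)$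 with $\delta^u(x)<\varepsilon\varepsilon(x)$ for all $x\in N$ the following holds. If a $C^1$ diffeomorphism $g:M\to M$ satisfies, for all $x\in N$, 1. $\prod_{i\ge0}m(Df|_{E^u(g^ix)})=\infty$ and $\prod_{i\ge0}m(Df^{-1}|_{E^s(g^{-i}x)})=\infty$, 2. $\max\{d(f(x),g(x)),\ \|D_xf-D_xg\|\}<\xi(x)\,\delta^u(x)\,Q(x)^2\,Q(f(x))$, then $g$ is pointwise hyperbolic on $N$. -/

import Mathlib

open Set Filter Topology Bundle
open scoped Manifold ContDiff ENNReal

noncomputable section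

namespace PointwiseHyp

/-! ### Norms of restrictions of a linear map to a subspace -/

section LinearAlgebra

variable {V W : Type*} [NormedAddCommGroup V] [NormedSpace ℝ V]
  [NormedAddCommGroup W] [NormedSpace ℝ W]

/-- The norm `‖A|_S‖` of the restriction of `A` to the subspace `S`. -/
def restrNorm (A : V →L[ℝ] W) (S : Submodule ℝ V) : ℝ :=
  ‖A ∘L S.subtypeL‖

/-- The minimum norm `m(A|_S)`, the infimum of `‖A v‖` over the unit vectors `v` of `S`. -/
def minNorm (A : V →L[ℝ] W) (S : Submodule ℝ V) : ℝ :=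
  sInf ((fun v : V => ‖A v‖) '' {v : V | v ∈ S ∧ ‖v‖ = 1})

end LinearAlgebra

/-- `∏_{i ≥ 0} a i = ∞`: the partial products tend to infinity. -/
def ProdDiverges (a : ℕ → ℝ) : Prop :=
  Tendsto (fun n : ℕ => ∏ i ∈ Finset.range n, a i) atTop atTop

/-! ### Maps of class `C^{1+α}` -/

section Holder

variable {E : Type*} [NormedAddCommGroup E] [NormedSpace ℝ E]
  {M : Type*} [TopologicalSpace M] [ChartedSpace E M]

/-- `f` is of class `C^{1+α}`: it is `C^1`, and its derivative in charts is locally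
`α`-Hölder continuous. -/
def IsC1Holder (α : ℝ) (f : M → M) : Prop :=
  ContMDiff 𝓘(ℝ, E) 𝓘(ℝ, E) 1 f ∧
    ∀ x₀ : M, ∃ C : ℝ, ∃ U ∈ 𝓝 (extChartAt 𝓘(ℝ, E) x₀ x₀), ∀ a ∈ U, ∀ b ∈ U,
      ‖fderiv ℝ (writtenInExtChartAt 𝓘(ℝ, E) 𝓘(ℝ, E) x₀ f) a
        - fderiv ℝ (writtenInExtChartAt 𝓘(ℝ, E) 𝓘(ℝ, E) x₀ f) b‖ ≤ C * ‖a - b‖ ^ α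

end Holder

/-! ### Distance to the boundary -/

section Boundary

variable {M : Type*} [MetricSpace M]

/-- The distance `d(x, ∂N)`; it is `∞` if `∂N` is empty. -/
def bdryEDist (N : Set M) (x : M) : ℝ≥0∞ :=
  Metric.infEDist x (frontier N)

/-- The distance `d(x, ∂N)` as a real number (used only where it is finite). -/
def bdryDist (N : Set M) (x : M) : ℝ :=
  (bdryEDist N x).toReal

/-- `min {r ^ p, d(x, ∂N) ^ p}`. -/
def truncPow (N : Set M) (r p : ℝ) (x : M) : ℝ :=
  (min (ENNReal.ofReal r ^ p) (bdryEDist N x ^ p)).toReal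

end Boundary

/-- The constants `r₀, β, γ, C` of Assumption U(ii), respectively of Assumption S(ii). -/
structure RateConsts where
  /-- size of the neighbourhood of the boundary -/
  r₀ : ℝ
  /-- exponent of the distance to the boundary -/
  β : ℝ
  /-- exponent of the ratio of the distances to the boundary -/
  γ : ℝ
  /-- multiplicative constant -/
  C : ℝ

/-- `r₀ > 0`, `β > 0`, `γ > max {1, β/α}` and `C > 1`. -/
def RateConsts.Admissible (α : ℝ) (c : RateConsts) : Prop :=
  0 < c.r₀ ∧ 0 < c.β ∧ max 1 (c.β / α) < c.γ ∧ 1 < c.C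

/-- `r₀ = min {r₀ᵘ, r₀ˢ}`. -/
def rMin (cu cs : RateConsts) : ℝ := min cu.r₀ cs.r₀

/-- `β = max {βˢ, βᵘ}`. -/
def betaMax (cu cs : RateConsts) : ℝ := max cs.β cu.β

/-- `γ = min {γˢ, γᵘ}`. -/
def gammaMin (cu cs : RateConsts) : ℝ := min cs.γ cu.γ

section Scales

variable {M : Type*} [MetricSpace M]

/-- `ε(x) = ε min {r₀ ^ β, d(x, ∂N) ^ β}`. -/
def epsFun (N : Set M) (cu cs : RateConsts) (ε : ℝ) (x : M) : ℝ :=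
  ε * truncPow N (rMin cu cs) (betaMax cu cs) x

/-- `Q(x) = ε ^ (2 / (α - δ)) min {r₀ ^ γ, d(x, ∂N) ^ γ}`. -/
def Q (N : Set M) (cu cs : RateConsts) (α δ ε : ℝ) (x : M) : ℝ :=
  ε ^ (2 / (α - δ)) * truncPow N (rMin cu cs) (gammaMin cu cs) x

end Scales

/-- Assumption R: `α > β / γ`. -/
def AssumptionR (α : ℝ) (cu cs : RateConsts) : Prop :=
  betaMax cu cs / gammaMin cu cs < α

/-! ### Pointwise hyperbolicity and Assumptions U, S, K -/

section Dynamics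

variable {E : Type*} [NormedAddCommGroup E] [NormedSpace ℝ E]
  {M : Type*} [MetricSpace M] [ChartedSpace E M]
  [RiemannianBundle (fun x : M => TangentSpace 𝓘(ℝ, E) x)]

/-- `‖D_x f|_{F(x)}‖`, in the Riemannian norms. -/
def normOn (f : M → M) (F : (x : M) → Submodule ℝ (TangentSpace 𝓘(ℝ, E) x)) (x : M) : ℝ :=
  restrNorm (mfderiv 𝓘(ℝ, E) 𝓘(ℝ, E) f x) (F x)

/-- `m(D_x f|_{F(x)})`, in the Riemannian norms. -/
def minOn (f : M → M) (F : (x : M) → Submodule ℝ (TangentSpace 𝓘(ℝ, E) x)) (x : M) : ℝ :=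
  minNorm (mfderiv 𝓘(ℝ, E) 𝓘(ℝ, E) f x) (F x)

/-- `N` is `f`-invariant and `T_N M = Es ⊕ Eu` is a `Df`-invariant splitting with contraction
rates `τs < 1` on `Es` and expansion rates `τu > 1` on `Eu` that depend on the point. The values
of `Es` and `Eu` outside `N` play no role. -/
def IsHyperbolicSplitting (f : M → M) (N : Set M)
    (Es Eu : (x : M) → Submodule ℝ (TangentSpace 𝓘(ℝ, E) x)) : Prop :=
  f '' N = N ∧
  (∀ x ∈ N, IsCompl (Es x) (Eu x)) ∧
  (∀ x ∈ N, (Es x).map (mfderiv 𝓘(ℝ, E) 𝓘(ℝ, E) f x).toLinearMap = Es (f x)) ∧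
  (∀ x ∈ N, (Eu x).map (mfderiv 𝓘(ℝ, E) 𝓘(ℝ, E) f x).toLinearMap = Eu (f x)) ∧
  ∃ τs τu : M → ℝ, ∀ x ∈ N,
    0 < τs x ∧ normOn f Es x ≤ τs x ∧ τs x < 1 ∧ 1 < τu x ∧ τu x ≤ minOn f Eu x

variable (E) in
/-- `f` is pointwise hyperbolic on `N`. -/
def PointwiseHyperbolic (f : M → M) (N : Set M) : Prop :=
  ∃ Es Eu : (x : M) → Submodule ℝ (TangentSpace 𝓘(ℝ, E) x), IsHyperbolicSplitting f N Es Eu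

/-- Assumption U, with the constants `c`. -/
def AssumptionU (f : M ≃ₘ^1⟮𝓘(ℝ, E), 𝓘(ℝ, E)⟯ M) (N : Set M)
    (Eu : (x : M) → Submodule ℝ (TangentSpace 𝓘(ℝ, E) x)) (α : ℝ) (c : RateConsts) : Prop :=
  (∀ x ∈ N, ProdDiverges (fun i => minOn f Eu (f^[i] x)) ∧
    ProdDiverges (fun i => minOn f Eu (f.symm^[i] x))) ∧
  c.Admissible α ∧
  ∀ x ∈ N, bdryEDist N x ≤ ENNReal.ofReal c.r₀ →
    c.C * max (bdryDist N x ^ c.β) ((bdryDist N (f x) / bdryDist N x) ^ c.γ - 1)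
      ≤ minOn f Eu x - 1

/-- Assumption S, with the constants `c`. -/
def AssumptionS (f : M ≃ₘ^1⟮𝓘(ℝ, E), 𝓘(ℝ, E)⟯ M) (N : Set M)
    (Es : (x : M) → Submodule ℝ (TangentSpace 𝓘(ℝ, E) x)) (α : ℝ) (c : RateConsts) : Prop :=
  (∀ x ∈ N, ProdDiverges (fun i => minOn f.symm Es (f^[i] x)) ∧
    ProdDiverges (fun i => minOn f.symm Es (f.symm^[i] x))) ∧
  c.Admissible α ∧
  ∀ x ∈ N, bdryEDist N x ≤ ENNReal.ofReal c.r₀ →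
    c.C * max (bdryDist N x ^ c.β) ((bdryDist N (f.symm x) / bdryDist N x) ^ c.γ - 1)
      ≤ minOn f.symm Es x - 1

/-- Assumption K. -/
def AssumptionK (f : M → M) (N : Set M)
    (Es Eu : (x : M) → Submodule ℝ (TangentSpace 𝓘(ℝ, E) x)) (cu cs : RateConsts) : Prop :=
  ∃ ε₀ : ℝ, 0 < ε₀ ∧ ∀ ε : ℝ, 0 < ε → ε ≤ ε₀ → ∀ x ∈ N,
    normOn f Es x / minOn f Eu x <
      (normOn f Es x + ε * epsFun N cu cs ε x + 1)
          / (normOn f Es (f x) + ε * epsFun N cu cs ε (f x) + 1)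
        * ((minOn f Eu (f x) - ε * epsFun N cu cs ε (f x) - 1)
          / (minOn f Eu x - ε * epsFun N cu cs ε x - 1))

/-! ### The size of `D_x f - D_x g` -/

variable {q : ℕ}

/-- The derivative at `x` of `f`, followed by the map `ι` from `M` to a Euclidean space. -/
def ambientDeriv (ι : M → EuclideanSpace ℝ (Fin q)) (f : M → M) (x : M) :
    TangentSpace 𝓘(ℝ, E) x →L[ℝ] EuclideanSpace ℝ (Fin q) :=
  mfderiv 𝓘(ℝ, E) 𝓘(ℝ, EuclideanSpace ℝ (Fin q)) (ι ∘ f) x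

variable (E) in
/-- `‖D_x f - D_x g‖`. The two derivatives take values in different tangent spaces of `M`; they
are subtracted in the Euclidean space in which `M` is embedded by `ι`. The norm on the domain
`T_x M` is the Riemannian one. -/
def derivDist (ι : M → EuclideanSpace ℝ (Fin q)) (f g : M → M) (x : M) : ℝ :=
  ‖ambientDeriv (E := E) ι f x - ambientDeriv (E := E) ι g x‖

end Dynamics

/-- `ι` is a smooth embedding of `M` in a Euclidean space. -/
def IsEuclideanEmbedding (E : Type*) [NormedAddCommGroup E] [NormedSpace ℝ E]
    {M : Type*} [TopologicalSpace M] [ChartedSpace E M] {q : ℕ}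
    (ι : M → EuclideanSpace ℝ (Fin q)) : Prop :=
  ContMDiff 𝓘(ℝ, E) 𝓘(ℝ, EuclideanSpace ℝ (Fin q)) ∞ ι ∧ IsEmbedding ι ∧
    ∀ x : M, Function.Injective (mfderiv 𝓘(ℝ, E) 𝓘(ℝ, EuclideanSpace ℝ (Fin q)) ι x)

end PointwiseHyp

end

open PointwiseHyp

/-! The proof is a cone field argument in which the width of the cones shrinks at the boundary of
`N`. Write a vector over `N` as `s + u` along `Es ⊕ Eu`. The derivative of `f` divides the slope
‖s‖/‖u‖ by at least `m(Df⁻¹|Es(f x)) · m(Df|Eu(x))`. So the cone ‖s‖ ≤ A‖u‖ is mapped strictly into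
the cone at `f x`, apart from the zero vector, as soon as `A` varies along orbits by less than this
factor; the same holds for `f⁻¹` and the cones around `Es`.

Such a width is a small multiple of `D ^ γ`, where `D` is the truncated distance to the boundary
(`exists_coneWidth`). The ratio terms in (U) and (S) say that `D ^ γ` grows at most by `m(Df|Eu)`
under `f` and at most by `m(Df⁻¹|Es)` under `f⁻¹`. The terms with exponent `β`, together with `β ≤
γ` from (R) and `α ≤ 1`, make the width small against the excess of the rates over 1. Vectors of a
cone are then expanded by more than the square root of the rate of `f`, and the products of these
square roots still diverge.

Strict invariance and strict expansion are open conditions once the projections of the splitting are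
continuous. Continuity follows from the dynamics: divergence of the products identifies `Es` with
the vectors of bounded forward orbit, and `Es` is closed (`closed_s`, `continuousAt_tproj_s`).
Compactness of unit spheres gives a local tolerance, and convexity of the set of tolerances gives a
continuous one (`exists_continuous_tolerance`). Every `g` within it preserves the cones, and the
invariance of `N` under `g⁻¹` comes from connectedness (`mapsTo_symm_of_dist_lt`).

Finally, the subbundles of `g` are the vectors with bounded forward orbit and those with bounded
backward orbit. The divergent products along `g`-orbits keep nonzero vectors of the expanding cone
out of the first; a limit of preimages shows that the first is large enough
(`ConeSystem.exists_mem_boundedOrbits`). -/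

set_option linter.unusedSectionVars false

namespace PointwiseHyp

/-! ### Limits of vectors in a Riemannian vector bundle. -/

section BundleLimits

variable {B : Type*} [TopologicalSpace B]
  {F : Type*} [NormedAddCommGroup F] [NormedSpace ℝ F]
  {V : B → Type*} [TopologicalSpace (TotalSpace F V)] [∀ x, NormedAddCommGroup (V x)]
  [∀ x, InnerProductSpace ℝ (V x)] [FiberBundle F V] [VectorBundle ℝ F V]

theorem continuous_norm_totalSpace [IsContinuousRiemannianBundle F V] :
    Continuous (fun p : TotalSpace F V => ‖p.2‖) := by
  have h : Continuous (fun p : TotalSpace F V => inner ℝ p.2 p.2) :=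
    Continuous.inner_bundle (b := fun p : TotalSpace F V => p.1) (v := fun p => p.2)
      (w := fun p => p.2) continuous_id continuous_id
  have h2 : (fun p : TotalSpace F V => ‖p.2‖) = fun p => √(inner ℝ p.2 p.2) := by
    ext p
    rw [real_inner_self_eq_norm_sq, Real.sqrt_sq (norm_nonneg _)]
  rw [h2]
  exact h.sqrt

variable {κ : Type*} {l : Filter κ} {b : κ → B} {b₀ : B}

/-- Vectors over different points are compared in the trivialization at the limit point; its linear
form lets sums and multiples pass to the limit. -/
theorem tendsto_totalSpace_iff {v : ∀ i, V (b i)} {v₀ : V b₀} :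
    Tendsto (fun i => (⟨b i, v i⟩ : TotalSpace F V)) l (𝓝 ⟨b₀, v₀⟩) ↔
      Tendsto b l (𝓝 b₀) ∧
        Tendsto (fun i => (trivializationAt F V b₀).linearMapAt ℝ (b i) (v i)) l
          (𝓝 ((trivializationAt F V b₀).linearMapAt ℝ b₀ v₀)) := by
  have hmem := FiberBundle.mem_baseSet_trivializationAt' (F := F) (E := V) b₀
  rw [(trivializationAt F V b₀).tendsto_nhds_iff
    ((trivializationAt F V b₀).mem_source.2 hmem)]
  refine and_congr_right fun hb => ?_
  rw [Trivialization.coe_linearMapAt_of_mem (R := ℝ) _ hmem]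
  refine tendsto_congr' ?_
  filter_upwards [hb ((trivializationAt F V b₀).open_baseSet.mem_nhds hmem)] with i hi
  rw [Trivialization.coe_linearMapAt_of_mem (R := ℝ) _
    (show b i ∈ (trivializationAt F V b₀).baseSet from hi)]

theorem tendsto_totalSpace_add {v w : ∀ i, V (b i)} {v₀ w₀ : V b₀}
    (hv : Tendsto (fun i => (⟨b i, v i⟩ : TotalSpace F V)) l (𝓝 ⟨b₀, v₀⟩))
    (hw : Tendsto (fun i => (⟨b i, w i⟩ : TotalSpace F V)) l (𝓝 ⟨b₀, w₀⟩)) :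
    Tendsto (fun i => (⟨b i, v i + w i⟩ : TotalSpace F V)) l (𝓝 ⟨b₀, v₀ + w₀⟩) := by
  rw [tendsto_totalSpace_iff] at hv hw ⊢
  refine ⟨hv.1, ?_⟩
  simp only [map_add]
  exact hv.2.add hw.2

theorem tendsto_totalSpace_smul {c : κ → ℝ} {c₀ : ℝ} {v : ∀ i, V (b i)} {v₀ : V b₀}
    (hc : Tendsto c l (𝓝 c₀))
    (hv : Tendsto (fun i => (⟨b i, v i⟩ : TotalSpace F V)) l (𝓝 ⟨b₀, v₀⟩)) :
    Tendsto (fun i => (⟨b i, c i • v i⟩ : TotalSpace F V)) l (𝓝 ⟨b₀, c₀ • v₀⟩) := by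
  rw [tendsto_totalSpace_iff] at hv ⊢
  refine ⟨hv.1, ?_⟩
  simp only [map_smul]
  exact hc.smul hv.2

/-- Near `b₀` the trivialization has bounded norm, so the coordinates stay in a compact ball.
Ultrafilters take the place of subsequences here and below. -/
theorem exists_tendsto_totalSpace [FiniteDimensional ℝ F] [IsContinuousRiemannianBundle F V]
    (U : Ultrafilter κ) (hb : Tendsto b U (𝓝 b₀)) {v : ∀ i, V (b i)} {C : ℝ}
    (hv : ∀ᶠ i in (U : Filter κ), ‖v i‖ ≤ C) :
    ∃ v₀ : V b₀, Tendsto (fun i => (⟨b i, v i⟩ : TotalSpace F V)) U (𝓝 ⟨b₀, v₀⟩) := by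
  have hmem := FiberBundle.mem_baseSet_trivializationAt' (F := F) (E := V) b₀
  obtain ⟨K, hK, hKb⟩ := eventually_norm_trivializationAt_lt F V b₀
  have hbd : ∀ᶠ i in (U : Filter κ),
      (trivializationAt F V b₀).linearMapAt ℝ (b i) (v i) ∈ Metric.closedBall (0 : F) (K * C) := by
    filter_upwards [hb.eventually hKb, hv] with i hi hvi
    rw [mem_closedBall_zero_iff]
    calc ‖(trivializationAt F V b₀).continuousLinearMapAt ℝ (b i) (v i)‖
        ≤ ‖(trivializationAt F V b₀).continuousLinearMapAt ℝ (b i)‖ * ‖v i‖ :=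
          ContinuousLinearMap.le_opNorm _ _
      _ ≤ K * C := by gcongr
  have : ProperSpace F := FiniteDimensional.proper ℝ F
  obtain ⟨e, -, he⟩ := (isCompact_closedBall (0 : F) (K * C)).ultrafilter_le_nhds
    (U.map fun i => (trivializationAt F V b₀).linearMapAt ℝ (b i) (v i))
    (le_principal_iff.2 hbd)
  refine ⟨(trivializationAt F V b₀).symmₗ ℝ b₀ e, ?_⟩
  rw [tendsto_totalSpace_iff, Trivialization.linearMapAt_symmₗ _ hmem]
  exact ⟨hb, he⟩

theorem exists_ultrafilter_of_frequently {X : Type*} {f : Filter X} {P : X → Prop}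
    (h : ∃ᶠ x in f, P x) : ∃ U : Ultrafilter X, ↑U ≤ f ∧ ∀ᶠ x in (U : Filter X), P x := by
  have : (f ⊓ 𝓟 {x | P x}).NeBot := frequently_iff_neBot.1 h
  refine ⟨Ultrafilter.of (f ⊓ 𝓟 {x | P x}), (Ultrafilter.of_le _).trans inf_le_left, ?_⟩
  exact le_principal_iff.1 ((Ultrafilter.of_le _).trans inf_le_right)

theorem exists_unit_mem_comap_of_finrank_lt {X Y : Type*} [NormedAddCommGroup X]
    [NormedSpace ℝ X] [AddCommGroup Y] [Module ℝ Y] [FiniteDimensional ℝ Y]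
    (τ : X →ₗ[ℝ] Y) (hτ : Function.Injective τ) (S : Submodule ℝ X) (T : Submodule ℝ Y)
    (h : Module.finrank ℝ Y < Module.finrank ℝ S + Module.finrank ℝ T) :
    ∃ v ∈ S, ‖v‖ = 1 ∧ τ v ∈ T := by
  have h1 : Module.finrank ℝ (S.map τ) = Module.finrank ℝ S :=
    (Submodule.equivMapOfInjective τ hτ S).finrank_eq.symm
  have h2 : (S.map τ) ⊓ T ≠ ⊥ := by
    intro h0
    have h3 := Submodule.finrank_sup_add_finrank_inf_eq (S.map τ) T
    have h4 := Submodule.finrank_le (S.map τ ⊔ T)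
    rw [h0, finrank_bot, h1] at h3
    omega
  obtain ⟨w, ⟨⟨v, hvS, rfl⟩, hwT⟩, hw0⟩ := Submodule.exists_mem_ne_zero_of_ne_bot h2
  have hv0 : v ≠ 0 := by rintro rfl; simp at hw0
  refine ⟨‖v‖⁻¹ • v, S.smul_mem _ hvS, ?_, ?_⟩
  · rw [norm_smul, norm_inv, norm_norm, inv_mul_cancel₀ (norm_ne_zero_iff.2 hv0)]
  · rw [map_smul]; exact T.smul_mem _ hwT

/-- Upper semicontinuity of the dimension of a closed family of subspaces. -/
theorem eventually_finrank_le [FiniteDimensional ℝ F] [IsContinuousRiemannianBundle F V]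
    {N : Set B} (S : ∀ x, Submodule ℝ (V x)) {x₀ : B} (hx₀ : x₀ ∈ N)
    (hS : ∀ p : TotalSpace F V, p.1 ∈ N →
      p ∈ closure {p : TotalSpace F V | p.1 ∈ N ∧ p.2 ∈ S p.1} → p.2 ∈ S p.1)
    (T : Submodule ℝ (V x₀)) (hT : IsCompl (S x₀) T) :
    ∀ᶠ x in 𝓝[N] x₀, Module.finrank ℝ (S x) ≤ Module.finrank ℝ (S x₀) := by
  set e := trivializationAt F V x₀ with he
  have hmem := FiberBundle.mem_baseSet_trivializationAt' (F := F) (E := V) x₀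
  have hinj : ∀ x ∈ e.baseSet, Function.Injective (e.linearMapAt ℝ x) := by
    intro x hx v w h
    have h1 := congrArg (e.symmₗ ℝ x) h
    rwa [Trivialization.symmₗ_linearMapAt _ hx, Trivialization.symmₗ_linearMapAt _ hx] at h1
  have hfd : FiniteDimensional ℝ (V x₀) :=
    FiniteDimensional.of_injective (e.linearMapAt ℝ x₀) (hinj _ hmem)
  have hF : Module.finrank ℝ F = Module.finrank ℝ (V x₀) :=
    (LinearEquiv.finrank_eq (e.linearEquivAt ℝ x₀ hmem)).symm
  by_contra hcon
  obtain ⟨U, hU, hUP⟩ := exists_ultrafilter_of_frequently (not_eventually.1 hcon)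
  have hUx : Tendsto id (U : Filter B) (𝓝 x₀) := tendsto_id.mono_left (hU.trans nhdsWithin_le_nhds)
  -- Where the dimension jumps up, `S x` must meet the complement `T`, transported by the
  -- trivialization. A limit of unit vectors in the intersections lies in both `S x₀` and `T`.
  have hex : ∀ᶠ x in (U : Filter B), ∃ v : V x, v ∈ S x ∧ ‖v‖ = 1 ∧
      e.linearMapAt ℝ x v ∈ T.map (e.linearMapAt ℝ x₀) := by
    filter_upwards [hUP, hUx (e.open_baseSet.mem_nhds hmem)] with x hx hxe
    refine exists_unit_mem_comap_of_finrank_lt _ (hinj x hxe) _ _ ?_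
    rw [← (Submodule.equivMapOfInjective _ (hinj _ hmem) T).finrank_eq, hF,
      ← Submodule.finrank_add_eq_of_isCompl hT]
    omega
  classical
  let v : ∀ x, V x := fun x => if h : ∃ v : V x, v ∈ S x ∧ ‖v‖ = 1 ∧
      e.linearMapAt ℝ x v ∈ T.map (e.linearMapAt ℝ x₀) then h.choose else 0
  have hv : ∀ᶠ x in (U : Filter B), v x ∈ S x ∧ ‖v x‖ = 1 ∧
      e.linearMapAt ℝ x (v x) ∈ T.map (e.linearMapAt ℝ x₀) := by
    filter_upwards [hex] with x hx
    simp only [v, dif_pos hx]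
    exact hx.choose_spec
  obtain ⟨w, hw⟩ := exists_tendsto_totalSpace (F := F) U hUx (v := v) (C := 1)
    (hv.mono fun x hx => hx.2.1.le)
  have hw1 : ‖w‖ = 1 := by
    have h1 := ((continuous_norm_totalSpace (F := F) (V := V)).tendsto _).comp hw
    refine tendsto_nhds_unique h1 (tendsto_const_nhds.congr' ?_)
    filter_upwards [hv] with x hx
    exact hx.2.1.symm
  have hwS : w ∈ S x₀ := by
    refine hS ⟨x₀, w⟩ hx₀ (mem_closure_of_tendsto hw ?_)
    filter_upwards [hv, hU self_mem_nhdsWithin] with x hx hxN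
    exact ⟨hxN, hx.1⟩
  have hwT : w ∈ T := by
    have hcl : IsClosed ((T.map (e.linearMapAt ℝ x₀) : Submodule ℝ F) : Set F) :=
      Submodule.closed_of_finiteDimensional _
    have h2 := hcl.mem_of_tendsto (tendsto_totalSpace_iff.1 hw).2 (hv.mono fun x hx => hx.2.2)
    obtain ⟨w', hw', hww⟩ := h2
    rwa [← hinj _ hmem hww]
  have : w = 0 := (Submodule.disjoint_def.1 hT.disjoint) w hwS hwT
  simp [this] at hw1

end BundleLimits

/-! ### Minimum norms and projections along a splitting. -/

section MinNorm

variable {V W : Type*} [NormedAddCommGroup V] [NormedSpace ℝ V]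
  [NormedAddCommGroup W] [NormedSpace ℝ W]

theorem minNorm_mul_le (A : V →L[ℝ] W) (S : Submodule ℝ V) {v : V} (hv : v ∈ S) :
    minNorm A S * ‖v‖ ≤ ‖A v‖ := by
  rcases eq_or_ne v 0 with rfl | h0
  · simp
  have hn : 0 < ‖v‖ := norm_pos_iff.2 h0
  have h1 : minNorm A S ≤ ‖A (‖v‖⁻¹ • v)‖ := by
    refine csInf_le ⟨0, ?_⟩ ⟨_, ⟨S.smul_mem _ hv, ?_⟩, rfl⟩
    · rintro _ ⟨w, -, rfl⟩; exact norm_nonneg _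
    · rw [norm_smul, norm_inv, norm_norm, inv_mul_cancel₀ hn.ne']
  rw [map_smul, norm_smul, norm_inv, norm_norm] at h1
  calc minNorm A S * ‖v‖ ≤ (‖v‖⁻¹ * ‖A v‖) * ‖v‖ := by gcongr
    _ = ‖A v‖ := by field_simp

theorem le_minNorm (A : V →L[ℝ] W) (S : Submodule ℝ V) {c : ℝ} (hS : S ≠ ⊥)
    (h : ∀ v ∈ S, c * ‖v‖ ≤ ‖A v‖) : c ≤ minNorm A S := by
  obtain ⟨v, hv, h0⟩ := Submodule.exists_mem_ne_zero_of_ne_bot hS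
  have hn : 0 < ‖v‖ := norm_pos_iff.2 h0
  refine le_csInf ⟨_, ‖v‖⁻¹ • v, ⟨S.smul_mem _ hv, ?_⟩, rfl⟩ ?_
  · rw [norm_smul, norm_inv, norm_norm, inv_mul_cancel₀ hn.ne']
  · rintro _ ⟨w, ⟨hw, hw1⟩, rfl⟩
    simpa [hw1] using h w hw

/-- The infimum of the empty set of reals is 0, so a rate above 1 forces a nonzero subspace. -/
theorem minNorm_bot (A : V →L[ℝ] W) : minNorm A ⊥ = 0 := by
  have : {v : V | v ∈ (⊥ : Submodule ℝ V) ∧ ‖v‖ = 1} = ∅ := by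
    ext v
    simp only [Submodule.mem_bot, mem_ofPred_eq, mem_empty_iff_false, iff_false, not_and]
    rintro rfl; simp
  rw [minNorm, this, image_empty, Real.sInf_empty]

theorem exists_unit_lt_of_minNorm_lt (A : V →L[ℝ] W) (S : Submodule ℝ V) {c : ℝ} (hS : S ≠ ⊥)
    (h : minNorm A S < c) : ∃ v ∈ S, ‖v‖ = 1 ∧ ‖A v‖ < c := by
  obtain ⟨v, hv, h0⟩ := Submodule.exists_mem_ne_zero_of_ne_bot hS
  have hn : 0 < ‖v‖ := norm_pos_iff.2 h0
  have hne : ((fun v : V => ‖A v‖) '' {v : V | v ∈ S ∧ ‖v‖ = 1}).Nonempty := by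
    refine ⟨_, ‖v‖⁻¹ • v, ⟨S.smul_mem _ hv, ?_⟩, rfl⟩
    rw [norm_smul, norm_inv, norm_norm, inv_mul_cancel₀ hn.ne']
  obtain ⟨_, ⟨w, ⟨hw, hw1⟩, rfl⟩, hlt⟩ := exists_lt_of_csInf_lt hne h
  exact ⟨w, hw, hw1, hlt⟩

/-- The projection to `S` along `T`; it is zero if `S` and `T` are not complementary. -/
noncomputable def projAlong (S T : Submodule ℝ V) : V →ₗ[ℝ] V :=
  open Classical in if h : IsCompl S T then S.projection T h else 0

theorem projAlong_mem (S T : Submodule ℝ V) (v : V) : projAlong S T v ∈ S := by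
  unfold projAlong
  split_ifs with h
  · exact Submodule.projection_apply_mem h v
  · simp

variable {S T : Submodule ℝ V}

theorem projAlong_of_mem (h : IsCompl S T) {v : V} (hv : v ∈ S) : projAlong S T v = v := by
  simp only [projAlong, dif_pos h, Submodule.projection_apply_of_mem_left h hv]

theorem projAlong_of_mem_right (h : IsCompl S T) {v : V} (hv : v ∈ T) : projAlong S T v = 0 := by
  simp only [projAlong, dif_pos h]
  exact (Submodule.projection_apply_eq_zero_iff h).2 hv

theorem projAlong_add (h : IsCompl S T) (v : V) : projAlong S T v + projAlong T S v = v := by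
  obtain ⟨s, hs, t, ht, rfl⟩ := Submodule.mem_sup.1
    (h.sup_eq_top ▸ Submodule.mem_top : v ∈ S ⊔ T)
  rw [map_add, map_add, projAlong_of_mem h hs, projAlong_of_mem_right h ht,
    projAlong_of_mem h.symm ht, projAlong_of_mem_right h.symm hs, add_zero, zero_add]

theorem projAlong_eq (h : IsCompl S T) {v s t : V} (hs : s ∈ S) (ht : t ∈ T) (hv : s + t = v) :
    projAlong S T v = s := by
  rw [← hv, map_add, projAlong_of_mem h hs, projAlong_of_mem_right h ht, add_zero]

end MinNorm

theorem ProdDiverges.ne_zero {a : ℕ → ℝ} (h : ProdDiverges a) (i : ℕ) : a i ≠ 0 := by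
  intro h0
  obtain ⟨n, hn, hi⟩ := ((h.eventually_gt_atTop 0).and (eventually_gt_atTop i)).exists
  rw [Finset.prod_eq_zero (Finset.mem_range.2 hi) h0] at hn
  exact lt_irrefl _ hn

/-! ### The tangent bundle, tangent maps and immersions. -/

section Tangent

variable {E : Type*} [NormedAddCommGroup E] [NormedSpace ℝ E] [FiniteDimensional ℝ E]
  {M : Type*} [MetricSpace M] [ChartedSpace E M] [IsManifold 𝓘(ℝ, E) ∞ M]
  [RiemannianBundle (fun x : M => TangentSpace 𝓘(ℝ, E) x)]
  [IsContMDiffRiemannianBundle 𝓘(ℝ, E) ∞ E (fun x : M => TangentSpace 𝓘(ℝ, E) x)]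

instance isContinuousRiemannianBundle_tangentSpace :
    IsContinuousRiemannianBundle E (fun x : M => TangentSpace 𝓘(ℝ, E) x) := by
  obtain ⟨g, hg, h⟩ := IsContMDiffRiemannianBundle.exists_contMDiff (IB := 𝓘(ℝ, E)) (n := ∞)
    (F := E) (E := fun x : M => TangentSpace 𝓘(ℝ, E) x)
  exact ⟨g, hg.continuous, h⟩

/-- The Riemannian norm on the tangent bundle. -/
noncomputable def tnorm (p : TangentBundle 𝓘(ℝ, E) M) : ℝ := ‖p.2‖

theorem tnorm_nonneg (p : TangentBundle 𝓘(ℝ, E) M) : 0 ≤ tnorm p := norm_nonneg _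

theorem continuous_tnorm : Continuous (tnorm : TangentBundle 𝓘(ℝ, E) M → ℝ) :=
  continuous_norm_totalSpace (F := E) (V := fun x : M => TangentSpace 𝓘(ℝ, E) x)

theorem continuous_tangentMap_diffeo (f : M ≃ₘ^1⟮𝓘(ℝ, E), 𝓘(ℝ, E)⟯ M) :
    Continuous (tangentMap 𝓘(ℝ, E) 𝓘(ℝ, E) f) :=
  f.contMDiff.continuous_tangentMap le_rfl

theorem tangentMap_symm_tangentMap (f : M ≃ₘ^1⟮𝓘(ℝ, E), 𝓘(ℝ, E)⟯ M)
    (p : TangentBundle 𝓘(ℝ, E) M) :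
    tangentMap 𝓘(ℝ, E) 𝓘(ℝ, E) f.symm (tangentMap 𝓘(ℝ, E) 𝓘(ℝ, E) f p) = p := by
  have h := tangentMap_comp (I := 𝓘(ℝ, E)) (I' := 𝓘(ℝ, E)) (I'' := 𝓘(ℝ, E))
    (f.symm.contMDiff.mdifferentiable one_ne_zero) (f.contMDiff.mdifferentiable one_ne_zero)
  have h2 : (f.symm ∘ f : M → M) = id := by ext x; simp
  rw [h2, tangentMap_id] at h
  exact (congrFun h p).symm

theorem tangentMap_tangentMap_symm (f : M ≃ₘ^1⟮𝓘(ℝ, E), 𝓘(ℝ, E)⟯ M)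
    (p : TangentBundle 𝓘(ℝ, E) M) :
    tangentMap 𝓘(ℝ, E) 𝓘(ℝ, E) f (tangentMap 𝓘(ℝ, E) 𝓘(ℝ, E) f.symm p) = p :=
  tangentMap_symm_tangentMap f.symm p

variable {q : ℕ}

/-- The second component of the tangent map of a map to a Euclidean space. -/
noncomputable def euclDeriv (ι : M → EuclideanSpace ℝ (Fin q)) (p : TangentBundle 𝓘(ℝ, E) M) :
    EuclideanSpace ℝ (Fin q) :=
  mfderiv 𝓘(ℝ, E) 𝓘(ℝ, EuclideanSpace ℝ (Fin q)) ι p.1 p.2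

theorem continuous_euclDeriv {ι : M → EuclideanSpace ℝ (Fin q)}
    (hι : ContMDiff 𝓘(ℝ, E) 𝓘(ℝ, EuclideanSpace ℝ (Fin q)) ∞ ι) :
    Continuous (euclDeriv (E := E) ι) := by
  have h1 : Continuous (tangentMap 𝓘(ℝ, E) 𝓘(ℝ, EuclideanSpace ℝ (Fin q)) ι) :=
    hι.continuous_tangentMap (by simp)
  have h2 := (tangentBundleModelSpaceHomeomorph 𝓘(ℝ, EuclideanSpace ℝ (Fin q))).continuous.comp h1
  exact continuous_snd.comp h2

variable {κ : Type*}

/-- In the image of an immersion the convergence of the derivatives implies convergence of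
tangent vectors. -/
theorem tendsto_of_tendsto_euclDeriv {ι : M → EuclideanSpace ℝ (Fin q)}
    (hι : IsEuclideanEmbedding E ι) (U : Ultrafilter κ)
    {r : κ → TangentBundle 𝓘(ℝ, E) M} {r₀ : TangentBundle 𝓘(ℝ, E) M}
    (hr : Tendsto (fun i => (r i).1) U (𝓝 r₀.1))
    (hJ : Tendsto (fun i => euclDeriv ι (r i)) U (𝓝 (euclDeriv ι r₀))) :
    Tendsto r U (𝓝 r₀) := by
  by_cases hb : ∃ C, ∀ᶠ i in (U : Filter κ), ‖(r i).2‖ ≤ C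
  · obtain ⟨C, hC⟩ := hb
    obtain ⟨v, hv⟩ := exists_tendsto_totalSpace (F := E)
      (V := fun x : M => TangentSpace 𝓘(ℝ, E) x) U hr hC
    have h1 := ((continuous_euclDeriv hι.1).tendsto _).comp hv
    have h2 : euclDeriv ι ⟨r₀.1, v⟩ = euclDeriv ι r₀ := tendsto_nhds_unique h1 hJ
    have h3 : v = r₀.2 := hι.2.2 r₀.1 h2
    rw [h3] at hv
    exact hv
  -- If the norms are unbounded along `U`, they tend to infinity. The normalized vectors then
  -- converge to a unit vector in the kernel of the derivative of the immersion.
  · exfalso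
    have hlarge : ∀ C, ∀ᶠ i in (U : Filter κ), C < ‖(r i).2‖ := by
      intro C
      have := Ultrafilter.eventually_not.2 (fun h => hb ⟨C, h⟩)
      simpa using this
    have hinv : Tendsto (fun i => ‖(r i).2‖⁻¹) U (𝓝 0) :=
      tendsto_inv_atTop_zero.comp (tendsto_atTop.2 fun C => (hlarge C).mono fun i hi => hi.le)
    have hnorm : ∀ᶠ i in (U : Filter κ), ‖‖(r i).2‖⁻¹ • (r i).2‖ = 1 := by
      filter_upwards [hlarge 0] with i hi
      rw [norm_smul, norm_inv, norm_norm, inv_mul_cancel₀ hi.ne']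
    obtain ⟨v, hv⟩ := exists_tendsto_totalSpace (F := E)
      (V := fun x : M => TangentSpace 𝓘(ℝ, E) x) U hr (v := fun i => ‖(r i).2‖⁻¹ • (r i).2)
      (hnorm.mono fun i hi => hi.le)
    have hv1 : ‖v‖ = 1 := by
      have h1 := (continuous_tnorm.tendsto _).comp hv
      refine tendsto_nhds_unique h1 (tendsto_const_nhds.congr' ?_)
      filter_upwards [hnorm] with i hi
      exact hi.symm
    have h1 := ((continuous_euclDeriv hι.1).tendsto _).comp hv
    have h2 := hinv.smul hJ
    rw [zero_smul] at h2
    have h3 : euclDeriv ι ⟨r₀.1, v⟩ = 0 := by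
      refine tendsto_nhds_unique h1 (h2.congr fun i => ?_)
      exact (map_smul (mfderiv 𝓘(ℝ, E) 𝓘(ℝ, EuclideanSpace ℝ (Fin q)) ι (r i).1) _ _).symm
    have h4 : v = 0 := hι.2.2 r₀.1 (h3.trans (map_zero _).symm)
    simp [h4] at hv1

end Tangent

/-! ### Continuity of the splitting of a pointwise hyperbolic system. -/

section Systems

variable {E : Type*} [NormedAddCommGroup E] [NormedSpace ℝ E] [FiniteDimensional ℝ E]
  {M : Type*} [MetricSpace M] [ChartedSpace E M] [IsManifold 𝓘(ℝ, E) ∞ M]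
  [RiemannianBundle (fun x : M => TangentSpace 𝓘(ℝ, E) x)]
  [IsContMDiffRiemannianBundle 𝓘(ℝ, E) ∞ E (fun x : M => TangentSpace 𝓘(ℝ, E) x)]

/-- A form of pointwise hyperbolicity with divergent products that is symmetric under the
exchange of a diffeomorphism with its inverse and of the two subbundles. -/
structure HyperbolicSystem (f : M ≃ₘ^1⟮𝓘(ℝ, E), 𝓘(ℝ, E)⟯ M) (N : Set M)
    (Es Eu : (x : M) → Submodule ℝ (TangentSpace 𝓘(ℝ, E) x)) : Prop where
  mapsTo : ∀ x ∈ N, f x ∈ N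
  mapsTo_symm : ∀ x ∈ N, f.symm x ∈ N
  isCompl : ∀ x ∈ N, IsCompl (Es x) (Eu x)
  mem_s : ∀ p : TangentBundle 𝓘(ℝ, E) M, p.1 ∈ N → p.2 ∈ Es p.1 →
    (tangentMap 𝓘(ℝ, E) 𝓘(ℝ, E) f p).2 ∈ Es (tangentMap 𝓘(ℝ, E) 𝓘(ℝ, E) f p).1
  mem_u : ∀ p : TangentBundle 𝓘(ℝ, E) M, p.1 ∈ N → p.2 ∈ Eu p.1 →
    (tangentMap 𝓘(ℝ, E) 𝓘(ℝ, E) f p).2 ∈ Eu (tangentMap 𝓘(ℝ, E) 𝓘(ℝ, E) f p).1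
  mem_s_symm : ∀ p : TangentBundle 𝓘(ℝ, E) M, p.1 ∈ N → p.2 ∈ Es p.1 →
    (tangentMap 𝓘(ℝ, E) 𝓘(ℝ, E) f.symm p).2 ∈ Es (tangentMap 𝓘(ℝ, E) 𝓘(ℝ, E) f.symm p).1
  mem_u_symm : ∀ p : TangentBundle 𝓘(ℝ, E) M, p.1 ∈ N → p.2 ∈ Eu p.1 →
    (tangentMap 𝓘(ℝ, E) 𝓘(ℝ, E) f.symm p).2 ∈ Eu (tangentMap 𝓘(ℝ, E) 𝓘(ℝ, E) f.symm p).1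
  one_lt_u : ∀ x ∈ N, 1 < minOn f Eu x
  one_lt_s : ∀ x ∈ N, 1 < minOn f.symm Es x
  prod_u : ∀ x ∈ N, ProdDiverges fun i => minOn f Eu (f^[i] x)
  prod_s : ∀ x ∈ N, ProdDiverges fun i => minOn f.symm Es (f.symm^[i] x)

/-- The fibrewise projection to `S` along `T`. -/
noncomputable def tproj (S T : (x : M) → Submodule ℝ (TangentSpace 𝓘(ℝ, E) x))
    (p : TangentBundle 𝓘(ℝ, E) M) : TangentBundle 𝓘(ℝ, E) M :=
  ⟨p.1, projAlong (S p.1) (T p.1) p.2⟩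

variable {f : M ≃ₘ^1⟮𝓘(ℝ, E), 𝓘(ℝ, E)⟯ M} {N : Set M}
  {Es Eu : (x : M) → Submodule ℝ (TangentSpace 𝓘(ℝ, E) x)}

theorem tnorm_tangentMap_iterate_add_le (f : M → M) (k : ℕ) (x : M)
    (a b : TangentSpace 𝓘(ℝ, E) x) :
    tnorm ((tangentMap 𝓘(ℝ, E) 𝓘(ℝ, E) f)^[k] ⟨x, a + b⟩) ≤
      tnorm ((tangentMap 𝓘(ℝ, E) 𝓘(ℝ, E) f)^[k] ⟨x, a⟩) +
        tnorm ((tangentMap 𝓘(ℝ, E) 𝓘(ℝ, E) f)^[k] ⟨x, b⟩) := by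
  induction k generalizing x with
  | zero => exact norm_add_le a b
  | succ k ih =>
    simp only [Function.iterate_succ_apply]
    have h := ih (f x) (mfderiv 𝓘(ℝ, E) 𝓘(ℝ, E) f x a) (mfderiv 𝓘(ℝ, E) 𝓘(ℝ, E) f x b)
    rw [← map_add] at h
    exact h

namespace HyperbolicSystem

theorem symm (h : HyperbolicSystem f N Es Eu) : HyperbolicSystem f.symm N Eu Es where
  mapsTo := h.mapsTo_symm
  mapsTo_symm := h.mapsTo
  isCompl x hx := (h.isCompl x hx).symm
  mem_s := h.mem_u_symm
  mem_u := h.mem_s_symm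
  mem_s_symm := h.mem_u
  mem_u_symm := h.mem_s
  one_lt_u := h.one_lt_s
  one_lt_s := h.one_lt_u
  prod_u := h.prod_s
  prod_s := h.prod_u

theorem expand_u (_ : HyperbolicSystem f N Es Eu) {p : TangentBundle 𝓘(ℝ, E) M}
    (hu : p.2 ∈ Eu p.1) :
    minOn f Eu p.1 * tnorm p ≤ tnorm (tangentMap 𝓘(ℝ, E) 𝓘(ℝ, E) f p) :=
  minNorm_mul_le (mfderiv 𝓘(ℝ, E) 𝓘(ℝ, E) f p.1) (Eu p.1) hu

theorem ne_bot (h : HyperbolicSystem f N Es Eu) {x : M} (hx : x ∈ N) :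
    Eu x ≠ ⊥ := by
  intro h0
  have h1 := h.one_lt_u x hx
  rw [minOn, h0, minNorm_bot] at h1
  linarith

theorem contract_s (h : HyperbolicSystem f N Es Eu) {p : TangentBundle 𝓘(ℝ, E) M}
    (hp : p.1 ∈ N) (hs : p.2 ∈ Es p.1) :
    minOn f.symm Es (f p.1) * tnorm (tangentMap 𝓘(ℝ, E) 𝓘(ℝ, E) f p) ≤ tnorm p := by
  have h1 := h.symm.expand_u (p := tangentMap 𝓘(ℝ, E) 𝓘(ℝ, E) f p) (h.mem_s p hp hs)
  rwa [tangentMap_symm_tangentMap] at h1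

theorem tnorm_tangentMap_le (h : HyperbolicSystem f N Es Eu) {p : TangentBundle 𝓘(ℝ, E) M}
    (hp : p.1 ∈ N) (hs : p.2 ∈ Es p.1) : tnorm (tangentMap 𝓘(ℝ, E) 𝓘(ℝ, E) f p) ≤ tnorm p := by
  refine le_trans ?_ (h.contract_s hp hs)
  exact le_mul_of_one_le_left (tnorm_nonneg _) (h.one_lt_s _ (h.mapsTo _ hp)).le

theorem tnorm_iterate_le (h : HyperbolicSystem f N Es Eu) (k : ℕ) :
    ∀ p : TangentBundle 𝓘(ℝ, E) M, p.1 ∈ N → p.2 ∈ Es p.1 →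
      tnorm ((tangentMap 𝓘(ℝ, E) 𝓘(ℝ, E) f)^[k] p) ≤ tnorm p := by
  induction k with
  | zero => exact fun p _ _ => le_rfl
  | succ k ih =>
    intro p hp hs
    rw [Function.iterate_succ_apply]
    exact (ih _ (h.mapsTo _ hp) (h.mem_s p hp hs)).trans (h.tnorm_tangentMap_le hp hs)

theorem le_tnorm_iterate (h : HyperbolicSystem f N Es Eu) (k : ℕ) :
    ∀ p : TangentBundle 𝓘(ℝ, E) M, p.1 ∈ N → p.2 ∈ Eu p.1 →
      (∏ i ∈ Finset.range k, minOn f Eu (f^[i] p.1)) * tnorm p ≤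
        tnorm ((tangentMap 𝓘(ℝ, E) 𝓘(ℝ, E) f)^[k] p) := by
  induction k with
  | zero => intro p _ _; simp
  | succ k ih =>
    intro p hp hu
    rw [Function.iterate_succ_apply, Finset.prod_range_succ']
    refine le_trans ?_ (ih _ (h.mapsTo _ hp) (h.mem_u p hp hu))
    have hpos : 0 ≤ ∏ i ∈ Finset.range k, minOn f Eu (f^[i] (f p.1)) := by
      refine Finset.prod_nonneg fun i _ => ?_
      have hi : f^[i] (f p.1) ∈ N := (show MapsTo f N N from h.mapsTo).iterate i (h.mapsTo _ hp)
      exact (zero_lt_one.trans (h.one_lt_u _ hi)).le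
    rw [mul_assoc]
    exact mul_le_mul_of_nonneg_left (h.expand_u hu) hpos

/-- The contracted subbundle is closed over `N`. -/
theorem closed_s (h : HyperbolicSystem f N Es Eu) (p : TangentBundle 𝓘(ℝ, E) M) (hp : p.1 ∈ N)
    (hcl : p ∈ closure {p : TangentBundle 𝓘(ℝ, E) M | p.1 ∈ N ∧ p.2 ∈ Es p.1}) :
    p.2 ∈ Es p.1 := by
  -- Forward iterates do not increase the norm on `Es`; for fixed `k` this is a closed condition and
  -- survives in the closure.
  have hbd : ∀ k, tnorm ((tangentMap 𝓘(ℝ, E) 𝓘(ℝ, E) f)^[k] p) ≤ tnorm p := by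
    intro k
    have hc : IsClosed {p : TangentBundle 𝓘(ℝ, E) M |
        tnorm ((tangentMap 𝓘(ℝ, E) 𝓘(ℝ, E) f)^[k] p) ≤ tnorm p} :=
      isClosed_le (continuous_tnorm.comp ((continuous_tangentMap_diffeo f).iterate k))
        continuous_tnorm
    exact closure_minimal (fun p hp => h.tnorm_iterate_le k p hp.1 hp.2) hc hcl
  have hadd := projAlong_add (h.isCompl _ hp) p.2
  set s := projAlong (Es p.1) (Eu p.1) p.2 with hs
  set u := projAlong (Eu p.1) (Es p.1) p.2 with hu
  have hsm : s ∈ Es p.1 := projAlong_mem _ _ _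
  have hum : u ∈ Eu p.1 := projAlong_mem _ _ _
  -- The orbit of `u` is the difference of two bounded orbits, while the divergent product would
  -- make it unbounded unless `u = 0`.
  have hub : ∀ k, (∏ i ∈ Finset.range k, minOn f Eu (f^[i] p.1)) * ‖u‖ ≤ ‖p.2‖ + ‖s‖ := by
    intro k
    refine (h.le_tnorm_iterate k ⟨p.1, u⟩ hp hum).trans ?_
    have hu' : u = p.2 + -s := by rw [← hadd]; abel
    rw [hu']
    refine (tnorm_tangentMap_iterate_add_le f k p.1 p.2 (-s)).trans (add_le_add (hbd k) ?_)
    refine (h.tnorm_iterate_le k ⟨p.1, -s⟩ hp (Submodule.neg_mem _ hsm)).trans ?_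
    exact (norm_neg s).le
  have hu0 : u = 0 := by
    by_contra h0
    have hn : 0 < ‖u‖ := norm_pos_iff.2 h0
    obtain ⟨k, hk⟩ := ((h.prod_u _ hp).eventually_gt_atTop ((‖p.2‖ + ‖s‖) / ‖u‖)).exists
    rw [div_lt_iff₀ hn] at hk
    exact absurd (hub k) (not_le.2 hk)
  rw [hu0, add_zero] at hadd
  rw [← hadd]
  exact hsm

theorem closed_u (h : HyperbolicSystem f N Es Eu) (p : TangentBundle 𝓘(ℝ, E) M) (hp : p.1 ∈ N)
    (hcl : p ∈ closure {p : TangentBundle 𝓘(ℝ, E) M | p.1 ∈ N ∧ p.2 ∈ Eu p.1}) :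
    p.2 ∈ Eu p.1 :=
  h.symm.closed_s p hp hcl

theorem tangentMap_tproj_s (h : HyperbolicSystem f N Es Eu) {p : TangentBundle 𝓘(ℝ, E) M}
    (hp : p.1 ∈ N) : tangentMap 𝓘(ℝ, E) 𝓘(ℝ, E) f (tproj Es Eu p) =
      tproj Es Eu (tangentMap 𝓘(ℝ, E) 𝓘(ℝ, E) f p) := by
  have h1 := h.mem_s (tproj Es Eu p) hp (projAlong_mem _ _ _)
  have h2 := h.mem_u (tproj Eu Es p) hp (projAlong_mem _ _ _)
  have h3 := projAlong_add (h.isCompl _ hp) p.2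
  have h4 := congrArg (mfderiv 𝓘(ℝ, E) 𝓘(ℝ, E) f p.1) h3
  rw [map_add] at h4
  have h5 := projAlong_eq (h.isCompl _ (h.mapsTo _ hp)) h1 h2 h4
  exact congrArg (fun v => (⟨f p.1, v⟩ : TangentBundle 𝓘(ℝ, E) M)) h5.symm

theorem tangentMap_tproj_u (h : HyperbolicSystem f N Es Eu) {p : TangentBundle 𝓘(ℝ, E) M}
    (hp : p.1 ∈ N) : tangentMap 𝓘(ℝ, E) 𝓘(ℝ, E) f (tproj Eu Es p) =
      tproj Eu Es (tangentMap 𝓘(ℝ, E) 𝓘(ℝ, E) f p) := by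
  have h1 := h.mem_s (tproj Es Eu p) hp (projAlong_mem _ _ _)
  have h2 := h.mem_u (tproj Eu Es p) hp (projAlong_mem _ _ _)
  have h3 := projAlong_add (h.isCompl _ hp).symm p.2
  have h4 := congrArg (mfderiv 𝓘(ℝ, E) 𝓘(ℝ, E) f p.1) h3
  rw [map_add] at h4
  have h5 := projAlong_eq (h.isCompl _ (h.mapsTo _ hp)).symm h2 h1 h4
  exact congrArg (fun v => (⟨f p.1, v⟩ : TangentBundle 𝓘(ℝ, E) M)) h5.symm

/-- The projection to the contracted subbundle is continuous over `N`. -/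
theorem continuousAt_tproj_s (h : HyperbolicSystem f N Es Eu) (hN : IsOpen N)
    {p₀ : TangentBundle 𝓘(ℝ, E) M} (hp₀ : p₀.1 ∈ N) : ContinuousAt (tproj Es Eu) p₀ := by
  rw [ContinuousAt, tendsto_iff_ultrafilter]
  intro U hU
  have hid : Tendsto (fun p : TangentBundle 𝓘(ℝ, E) M =>
      (⟨p.1, p.2⟩ : TangentBundle 𝓘(ℝ, E) M)) U (𝓝 ⟨p₀.1, p₀.2⟩) := tendsto_id.mono_left hU
  have hbase : Tendsto (fun p : TangentBundle 𝓘(ℝ, E) M => p.1) U (𝓝 p₀.1) :=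
    (FiberBundle.continuous_proj E (fun x : M => TangentSpace 𝓘(ℝ, E) x)).continuousAt.tendsto.comp
      hid
  have hNe : ∀ᶠ p in (U : Filter (TangentBundle 𝓘(ℝ, E) M)), p.1 ∈ N :=
    hbase (hN.mem_nhds hp₀)
  let s : ∀ p : TangentBundle 𝓘(ℝ, E) M, TangentSpace 𝓘(ℝ, E) p.1 :=
    fun p => projAlong (Es p.1) (Eu p.1) p.2
  let u : ∀ p : TangentBundle 𝓘(ℝ, E) M, TangentSpace 𝓘(ℝ, E) p.1 :=
    fun p => projAlong (Eu p.1) (Es p.1) p.2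
  have hsm : ∀ p, s p ∈ Es p.1 := fun p => projAlong_mem _ _ _
  have hum : ∀ p, u p ∈ Eu p.1 := fun p => projAlong_mem _ _ _
  have hsu : ∀ᶠ p in (U : Filter (TangentBundle 𝓘(ℝ, E) M)), p.2 + (-1 : ℝ) • s p = u p := by
    filter_upwards [hNe] with p hp
    have := projAlong_add (h.isCompl _ hp) p.2
    rw [neg_one_smul, ← sub_eq_add_neg]
    exact sub_eq_of_eq_add' this.symm
  -- If the components are bounded, their limits lie in the closed subbundles and give the
  -- decomposition of the limit. Otherwise, after division by ‖s p‖ the vector itself disappears,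
  -- and the limit of the normalized component is a unit vector in `Es ∩ Eu`.
  by_cases hb : ∃ C, ∀ᶠ p in (U : Filter (TangentBundle 𝓘(ℝ, E) M)), ‖s p‖ ≤ C
  · obtain ⟨C, hC⟩ := hb
    obtain ⟨s₀, hs₀⟩ := exists_tendsto_totalSpace (F := E)
      (V := fun x : M => TangentSpace 𝓘(ℝ, E) x) U hbase hC
    have hu₀ := tendsto_totalSpace_add (F := E) (V := fun x : M => TangentSpace 𝓘(ℝ, E) x) hid
      (tendsto_totalSpace_smul (F := E) (V := fun x : M => TangentSpace 𝓘(ℝ, E) x)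
        (tendsto_const_nhds (x := (-1 : ℝ))) hs₀)
    have h1 : s₀ ∈ Es p₀.1 := h.closed_s ⟨p₀.1, s₀⟩ hp₀
      (mem_closure_of_tendsto hs₀ (hNe.mono fun p hp => ⟨hp, hsm p⟩))
    have h2 : p₀.2 + (-1 : ℝ) • s₀ ∈ Eu p₀.1 := by
      refine h.closed_u ⟨p₀.1, p₀.2 + (-1 : ℝ) • s₀⟩ hp₀ (mem_closure_of_tendsto hu₀ ?_)
      filter_upwards [hNe, hsu] with p hp hpu
      refine ⟨hp, ?_⟩
      change p.2 + (-1 : ℝ) • s p ∈ Eu p.1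
      rw [hpu]; exact hum p
    have h3 : projAlong (Es p₀.1) (Eu p₀.1) p₀.2 = s₀ :=
      projAlong_eq (h.isCompl _ hp₀) h1 h2 (by rw [neg_one_smul]; abel)
    unfold tproj
    rw [h3]
    exact hs₀
  · exfalso
    have hlarge : ∀ C, ∀ᶠ p in (U : Filter (TangentBundle 𝓘(ℝ, E) M)), C < ‖s p‖ := by
      intro C
      have := Ultrafilter.eventually_not.2 (fun h => hb ⟨C, h⟩)
      simpa using this
    have hinv : Tendsto (fun p => ‖s p‖⁻¹) U (𝓝 0) :=
      tendsto_inv_atTop_zero.comp (tendsto_atTop.2 fun C => (hlarge C).mono fun i hi => hi.le)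
    have hunit : ∀ᶠ p in (U : Filter (TangentBundle 𝓘(ℝ, E) M)), ‖‖s p‖⁻¹ • s p‖ = 1 := by
      filter_upwards [hlarge 0] with i hi
      rw [norm_smul, norm_inv, norm_norm, inv_mul_cancel₀ hi.ne']
    obtain ⟨e, he⟩ := exists_tendsto_totalSpace (F := E)
      (V := fun x : M => TangentSpace 𝓘(ℝ, E) x) U hbase (v := fun p => ‖s p‖⁻¹ • s p)
      (hunit.mono fun i hi => hi.le)
    have he1 : ‖e‖ = 1 := by
      have h1 := (continuous_tnorm.tendsto _).comp he
      refine tendsto_nhds_unique h1 (tendsto_const_nhds.congr' ?_)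
      filter_upwards [hunit] with i hi
      exact hi.symm
    have h1 : e ∈ Es p₀.1 := h.closed_s ⟨p₀.1, e⟩ hp₀ (mem_closure_of_tendsto he
      (hNe.mono fun p hp => ⟨hp, Submodule.smul_mem _ _ (hsm p)⟩))
    have hv := tendsto_totalSpace_smul (F := E) (V := fun x : M => TangentSpace 𝓘(ℝ, E) x) hinv hid
    have hu := tendsto_totalSpace_add (F := E) (V := fun x : M => TangentSpace 𝓘(ℝ, E) x) hv
      (tendsto_totalSpace_smul (F := E) (V := fun x : M => TangentSpace 𝓘(ℝ, E) x)
        (tendsto_const_nhds (x := (-1 : ℝ))) he)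
    have h2 : (0 : ℝ) • p₀.2 + (-1 : ℝ) • e ∈ Eu p₀.1 := by
      refine h.closed_u ⟨p₀.1, (0 : ℝ) • p₀.2 + (-1 : ℝ) • e⟩ hp₀
        (mem_closure_of_tendsto hu ?_)
      filter_upwards [hNe, hsu] with p hp hpu
      refine ⟨hp, ?_⟩
      change ‖s p‖⁻¹ • p.2 + (-1 : ℝ) • (‖s p‖⁻¹ • s p) ∈ Eu p.1
      rw [smul_comm, ← smul_add, hpu]
      exact Submodule.smul_mem _ _ (hum p)
    rw [zero_smul, zero_add, neg_one_smul, Submodule.neg_mem_iff] at h2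
    have h3 : e = 0 := Submodule.disjoint_def.1 (h.isCompl _ hp₀).disjoint e h1 h2
    simp [h3] at he1

theorem continuousAt_tproj_u (h : HyperbolicSystem f N Es Eu) (hN : IsOpen N)
    {p₀ : TangentBundle 𝓘(ℝ, E) M} (hp₀ : p₀.1 ∈ N) : ContinuousAt (tproj Eu Es) p₀ :=
  h.symm.continuousAt_tproj_s hN hp₀

/-- The dimension of the contracted subbundle is constant on a connected set. -/
theorem finrank_eq (h : HyperbolicSystem f N Es Eu) (hN : IsPreconnected N) {x y : M}
    (hx : x ∈ N) (hy : y ∈ N) : Module.finrank ℝ (Es x) = Module.finrank ℝ (Es y) := by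
  have hfd : ∀ x : M, FiniteDimensional ℝ (TangentSpace 𝓘(ℝ, E) x) := fun x =>
    inferInstanceAs (FiniteDimensional ℝ E)
  have hdim : ∀ x ∈ N, Module.finrank ℝ (Es x) + Module.finrank ℝ (Eu x) = Module.finrank ℝ E :=
    fun x hx => Submodule.finrank_add_eq_of_isCompl (h.isCompl x hx)
  -- Both dimensions are upper semicontinuous and their sum is constant, so both are locally
  -- constant.
  have hcont : ContinuousOn (fun x => Module.finrank ℝ (Es x)) N := by
    intro x hx
    have h1 := eventually_finrank_le (F := E) (V := fun x : M => TangentSpace 𝓘(ℝ, E) x) Es hx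
      h.closed_s (Eu x) (h.isCompl x hx)
    have h2 := eventually_finrank_le (F := E) (V := fun x : M => TangentSpace 𝓘(ℝ, E) x) Eu hx
      h.closed_u (Es x) (h.isCompl x hx).symm
    refine tendsto_const_nhds.congr' ?_
    filter_upwards [h1, h2, self_mem_nhdsWithin] with y hy1 hy2 hyN
    have := hdim x hx
    have := hdim y hyN
    omega
  exact hN.constant hcont hx hy

end HyperbolicSystem

end Systems

/-! ### Cone fields for `f` and their stability under perturbation. -/

section Cones

variable {E : Type*} [NormedAddCommGroup E] [NormedSpace ℝ E] [FiniteDimensional ℝ E]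
  {M : Type*} [MetricSpace M] [ChartedSpace E M] [IsManifold 𝓘(ℝ, E) ∞ M]
  [RiemannianBundle (fun x : M => TangentSpace 𝓘(ℝ, E) x)]
  [IsContMDiffRiemannianBundle 𝓘(ℝ, E) ∞ E (fun x : M => TangentSpace 𝓘(ℝ, E) x)]

/-- The function `A` is an admissible width of cone fields around both subbundles: the cones are
strictly invariant and their vectors are expanded. -/
structure ConeWidth (f : M ≃ₘ^1⟮𝓘(ℝ, E), 𝓘(ℝ, E)⟯ M) (N : Set M)
    (Es Eu : (x : M) → Submodule ℝ (TangentSpace 𝓘(ℝ, E) x)) (A : M → ℝ) : Prop where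
  pos : ∀ x ∈ N, 0 < A x
  lt_one : ∀ x ∈ N, A x < 1
  cont : ContinuousOn A N
  u_step : ∀ x ∈ N, A x < minOn f.symm Es (f x) * minOn f Eu x * A (f x)
  s_step : ∀ x ∈ N, A (f x) < minOn f.symm Es (f x) * minOn f Eu x * A x
  u_small : ∀ x ∈ N, A x < (√(minOn f Eu x) - 1) / 2
  s_small : ∀ x ∈ N, A x < (√(minOn f.symm Es x) - 1) / 2

variable {f : M ≃ₘ^1⟮𝓘(ℝ, E), 𝓘(ℝ, E)⟯ M} {N : Set M}
  {Es Eu : (x : M) → Submodule ℝ (TangentSpace 𝓘(ℝ, E) x)} {A : M → ℝ}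

theorem ConeWidth.symm (hA : ConeWidth f N Es Eu A) (h : HyperbolicSystem f N Es Eu) :
    ConeWidth f.symm N Eu Es A where
  pos := hA.pos
  lt_one := hA.lt_one
  cont := hA.cont
  u_step x hx := by
    have h1 := hA.s_step _ (h.mapsTo_symm x hx)
    have h2 : f (f.symm x) = x := f.apply_symm_apply x
    rw [h2, mul_comm (minOn f.symm Es x)] at h1
    exact h1
  s_step x hx := by
    have h1 := hA.u_step _ (h.mapsTo_symm x hx)
    have h2 : f (f.symm x) = x := f.apply_symm_apply x
    rw [h2, mul_comm (minOn f.symm Es x)] at h1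
    exact h1
  u_small := hA.s_small
  s_small := hA.u_small

/-- Here `n = ‖u‖`, `X = ‖Df u‖`, `t = ‖p‖` and `Y = ‖Df p‖` for a vector `p = s + u` of the cone;
`r ^ 2` is the expansion of its own component `u`. -/
theorem mul_sq_lt_sq_mul_of_small {n m A X t Y : ℝ} (hn : 0 < n) (hm : 1 < m) (hA : 0 < A)
    (hAm : A < (√m - 1) / 2) (hX : m * n ≤ X) (ht : 0 ≤ t) (htn : t ≤ (1 + A) * n)
    (hY : X - A * n ≤ Y) : X * t ^ 2 < Y ^ 2 * n := by
  set r := √(X / n) with hr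
  have hXn : m ≤ X / n := by rwa [le_div_iff₀ hn]
  have hmr : √m ≤ r := Real.sqrt_le_sqrt hXn
  have h1m : 1 < √m := by rw [Real.lt_sqrt zero_le_one]; simpa using hm
  have hr2 : X = r ^ 2 * n := by
    rw [hr, Real.sq_sqrt (by linarith)]
    field_simp
  -- As `A < (r - 1) / 2`, the difference of the two sides exceeds `(r - 1) ^ 2 / 2`.
  have h1 : r * (1 + A) < r ^ 2 - A := by nlinarith
  have h2 : r * (1 + A) * n < Y := by
    refine lt_of_lt_of_le ?_ hY
    rw [hr2]
    nlinarith
  have h0 : 0 ≤ r * (1 + A) * n := by positivity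
  have h3 : (r * (1 + A) * n) ^ 2 < Y ^ 2 := by gcongr
  calc X * t ^ 2 ≤ X * ((1 + A) * n) ^ 2 := by
        have : 0 ≤ X := by rw [hr2]; positivity
        gcongr
    _ = (r * (1 + A) * n) ^ 2 * n := by rw [hr2]; ring
    _ < Y ^ 2 * n := by gcongr

theorem tnorm_le_tproj_add (h : HyperbolicSystem f N Es Eu) {p : TangentBundle 𝓘(ℝ, E) M}
    (hp : p.1 ∈ N) : tnorm p ≤ tnorm (tproj Es Eu p) + tnorm (tproj Eu Es p) := by
  have h1 := norm_add_le (projAlong (Es p.1) (Eu p.1) p.2) (projAlong (Eu p.1) (Es p.1) p.2)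
  rw [projAlong_add (h.isCompl _ hp)] at h1
  exact h1

theorem tnorm_tproj_sub_le (h : HyperbolicSystem f N Es Eu) {p : TangentBundle 𝓘(ℝ, E) M}
    (hp : p.1 ∈ N) : tnorm (tproj Eu Es p) - tnorm (tproj Es Eu p) ≤ tnorm p := by
  have h1 := norm_sub_le p.2 (projAlong (Es p.1) (Eu p.1) p.2)
  rw [sub_eq_of_eq_add' (projAlong_add (h.isCompl _ hp) p.2).symm] at h1
  exact sub_le_iff_le_add.2 h1

/-- The expansion is measured by ‖Df u‖/‖u‖ instead of its lower bound `minOn f Eu`: this quantity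
depends continuously on the vector, so no continuity of `minOn` is needed when `f` is perturbed. -/
theorem ConeWidth.strict (hA : ConeWidth f N Es Eu A) (h : HyperbolicSystem f N Es Eu)
    {p : TangentBundle 𝓘(ℝ, E) M} (hp : p.1 ∈ N) (h0 : tnorm p ≠ 0)
    (hc : tnorm (tproj Es Eu p) ≤ A p.1 * tnorm (tproj Eu Es p)) :
    tnorm (tproj Es Eu (tangentMap 𝓘(ℝ, E) 𝓘(ℝ, E) f p)) <
        A (f p.1) * tnorm (tproj Eu Es (tangentMap 𝓘(ℝ, E) 𝓘(ℝ, E) f p)) ∧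
      tnorm (tangentMap 𝓘(ℝ, E) 𝓘(ℝ, E) f (tproj Eu Es p)) * tnorm p ^ 2 <
        tnorm (tangentMap 𝓘(ℝ, E) 𝓘(ℝ, E) f p) ^ 2 * tnorm (tproj Eu Es p) := by
  have hle := tnorm_le_tproj_add h hp
  have hfp := h.mapsTo _ hp
  have hsub := tnorm_tproj_sub_le h (p := tangentMap 𝓘(ℝ, E) 𝓘(ℝ, E) f p) hfp
  have hs := h.contract_s (p := tproj Es Eu p) hp (projAlong_mem _ _ _)
  have hs' := h.tnorm_tangentMap_le (p := tproj Es Eu p) hp (projAlong_mem _ _ _)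
  have hu := h.expand_u (p := tproj Eu Es p) (projAlong_mem _ _ _)
  rw [← h.tangentMap_tproj_s hp, ← h.tangentMap_tproj_u hp] at *
  have hn0 := tnorm_nonneg (tproj Eu Es p)
  have hp0 : 0 < tnorm p := lt_of_le_of_ne (tnorm_nonneg p) h0.symm
  have hApos := hA.pos _ hp
  have hApos' := hA.pos _ hfp
  have hstep := hA.u_step _ hp
  have hu1 := h.one_lt_u _ hp
  have hs1 := h.one_lt_s _ hfp
  change minOn f.symm Es (f p.1) * _ ≤ _ at hs
  change minOn f Eu p.1 * _ ≤ _ at hu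
  -- A vector of the cone with `u = 0` has `s = 0` as well.
  have hn : 0 < tnorm (tproj Eu Es p) := by
    rcases hn0.eq_or_lt with h1 | h1
    · rw [← h1] at hc hle
      linarith
    · exact h1
  generalize tnorm (tproj Eu Es p) = n at *
  generalize tnorm (tproj Es Eu p) = s at *
  generalize tnorm (tangentMap 𝓘(ℝ, E) 𝓘(ℝ, E) f (tproj Eu Es p)) = X at *
  generalize tnorm (tangentMap 𝓘(ℝ, E) 𝓘(ℝ, E) f (tproj Es Eu p)) = Z at *
  constructor
  · have h1 : minOn f.symm Es (f p.1) * Z < minOn f.symm Es (f p.1) * (A (f p.1) * X) :=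
      calc minOn f.symm Es (f p.1) * Z ≤ A p.1 * n := hs.trans hc
        _ < minOn f.symm Es (f p.1) * minOn f Eu p.1 * A (f p.1) * n := by gcongr
        _ = minOn f.symm Es (f p.1) * (A (f p.1) * (minOn f Eu p.1 * n)) := by ring
        _ ≤ minOn f.symm Es (f p.1) * (A (f p.1) * X) := by gcongr
    exact lt_of_mul_lt_mul_left h1 (by linarith)
  · exact mul_sq_lt_sq_mul_of_small hn hu1 hApos (hA.u_small _ hp) hu hp0.le
      (by linarith) (by linarith)

variable {q : ℕ} {ι : M → EuclideanSpace ℝ (Fin q)}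

/-- An open condition on pairs of tangent vectors that holds on the graph of the derivative of
`f` holds locally uniformly near it. -/
theorem exists_pos_of_pos_on_graph (hι : IsEuclideanEmbedding E ι)
    {G : TangentBundle 𝓘(ℝ, E) M → TangentBundle 𝓘(ℝ, E) M → ℝ} {x₀ : M}
    (hG : ∀ p, p.1 = x₀ → ContinuousAt (Function.uncurry G)
      (p, tangentMap 𝓘(ℝ, E) 𝓘(ℝ, E) f p))
    (hpos : ∀ p, p.1 = x₀ → tnorm p = 1 → 0 < G p (tangentMap 𝓘(ℝ, E) 𝓘(ℝ, E) f p)) :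
    ∃ η > 0, ∀ p : TangentBundle 𝓘(ℝ, E) M, dist p.1 x₀ < η → tnorm p = 1 →
      ∀ r : TangentBundle 𝓘(ℝ, E) M, dist (f p.1) r.1 < η →
        ‖euclDeriv ι (tangentMap 𝓘(ℝ, E) 𝓘(ℝ, E) f p) - euclDeriv ι r‖ < η → 0 < G p r := by
  by_contra hcon
  push Not at hcon
  -- Along counterexamples with shrinking tolerance, the unit vectors `p n` converge, and since `ι`
  -- is an immersion the vectors `r n` converge to the image of the limit under `Df`. There `G`
  -- would be both positive and nonpositive.
  choose p hp1 hp2 r hr1 hr2 hGneg using fun n : ℕ => hcon (1 / (n + 1)) Nat.one_div_pos_of_nat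
  have hU : (hyperfilter ℕ : Filter ℕ) ≤ atTop := by
    rw [← Nat.cofinite_eq_atTop]; exact hyperfilter_le_cofinite
  have hlim : Tendsto (fun n : ℕ => 1 / ((n : ℝ) + 1)) (hyperfilter ℕ : Filter ℕ) (𝓝 0) :=
    tendsto_one_div_add_atTop_nhds_zero_nat.mono_left hU
  have hb : Tendsto (fun n => (p n).1) (hyperfilter ℕ : Filter ℕ) (𝓝 x₀) :=
    tendsto_iff_dist_tendsto_zero.2
      (squeeze_zero (fun _ => dist_nonneg) (fun n => (hp1 n).le) hlim)
  obtain ⟨v, hv⟩ := exists_tendsto_totalSpace (F := E)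
    (V := fun x : M => TangentSpace 𝓘(ℝ, E) x) (hyperfilter ℕ) hb (v := fun n => (p n).2) (C := 1)
    (Eventually.of_forall fun n => (hp2 n).le)
  have hv' : Tendsto p (hyperfilter ℕ : Filter ℕ) (𝓝 (⟨x₀, v⟩ : TangentBundle 𝓘(ℝ, E) M)) := hv
  have hv1 : tnorm (⟨x₀, v⟩ : TangentBundle 𝓘(ℝ, E) M) = 1 :=
    tendsto_nhds_unique ((continuous_tnorm.tendsto _).comp hv')
      (tendsto_const_nhds.congr fun n => (hp2 n).symm)
  have hfp := ((continuous_tangentMap_diffeo f).tendsto _).comp hv'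
  have hfb : Tendsto (fun n => f (p n).1) (hyperfilter ℕ : Filter ℕ) (𝓝 (f x₀)) :=
    (f.contMDiff.continuous.tendsto x₀).comp hb
  have hrb : Tendsto (fun n => (r n).1) (hyperfilter ℕ : Filter ℕ) (𝓝 (f x₀)) := by
    refine hfb.congr_dist ?_
    exact squeeze_zero (fun _ => dist_nonneg) (fun n => (hr1 n).le) hlim
  have hJ := ((continuous_euclDeriv hι.1).tendsto _).comp hfp
  have hrJ : Tendsto (fun n => euclDeriv ι (r n)) (hyperfilter ℕ : Filter ℕ)
      (𝓝 (euclDeriv ι (tangentMap 𝓘(ℝ, E) 𝓘(ℝ, E) f ⟨x₀, v⟩))) := by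
    refine hJ.congr_dist ?_
    refine squeeze_zero (fun _ => dist_nonneg) (fun n => ?_) hlim
    rw [dist_eq_norm]
    exact (hr2 n).le
  have hr := tendsto_of_tendsto_euclDeriv hι (hyperfilter ℕ)
    (r₀ := tangentMap 𝓘(ℝ, E) 𝓘(ℝ, E) f ⟨x₀, v⟩) hrb hrJ
  have hlimG := (hG ⟨x₀, v⟩ rfl).tendsto.comp (hv'.prodMk_nhds hr)
  have := le_of_tendsto hlimG (Eventually.of_forall hGneg)
  exact absurd (hpos ⟨x₀, v⟩ rfl hv1) (not_lt.2 this)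

theorem exists_continuous_tolerance (hι : IsEuclideanEmbedding E ι) (hN : IsOpen N)
    (hf : ∀ x ∈ N, f x ∈ N)
    {G : TangentBundle 𝓘(ℝ, E) M → TangentBundle 𝓘(ℝ, E) M → ℝ}
    (hG : ∀ p, p.1 ∈ N → ContinuousAt (Function.uncurry G)
      (p, tangentMap 𝓘(ℝ, E) 𝓘(ℝ, E) f p))
    (hpos : ∀ p, p.1 ∈ N → tnorm p = 1 → 0 < G p (tangentMap 𝓘(ℝ, E) 𝓘(ℝ, E) f p)) :
    ∃ ξ : M → ℝ, ContinuousOn ξ N ∧ ∀ x ∈ N, 0 < ξ x ∧ Metric.ball (f x) (ξ x) ⊆ N ∧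
      ∀ p : TangentBundle 𝓘(ℝ, E) M, p.1 = x → tnorm p = 1 →
      ∀ r : TangentBundle 𝓘(ℝ, E) M, dist (f p.1) r.1 < ξ x →
        ‖euclDeriv ι (tangentMap 𝓘(ℝ, E) 𝓘(ℝ, E) f p) - euclDeriv ι r‖ < ξ x → 0 < G p r := by
  let t : N → Set ℝ := fun x => {η | 0 < η ∧ Metric.ball (f x) η ⊆ N ∧
      ∀ p : TangentBundle 𝓘(ℝ, E) M, p.1 = x → tnorm p = 1 →
      ∀ r : TangentBundle 𝓘(ℝ, E) M, dist (f p.1) r.1 < η →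
        ‖euclDeriv ι (tangentMap 𝓘(ℝ, E) 𝓘(ℝ, E) f p) - euclDeriv ι r‖ < η → 0 < G p r}
  -- Smaller positive tolerances are admissible too, so the admissible ones form an interval; local
  -- constants are then glued by a partition of unity.
  have ht : ∀ x, Convex ℝ (t x) := by
    intro x
    refine OrdConnected.convex ⟨fun a ha b hb c hc => ?_⟩
    refine ⟨ha.1.trans_le hc.1, (Metric.ball_subset_ball hc.2).trans hb.2.1, ?_⟩
    exact fun p hp hp1 r hr hr2 => hb.2.2 p hp hp1 r (hr.trans_le hc.2) (hr2.trans_le hc.2)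
  have hloc : ∀ x : N, ∃ c : ℝ, ∀ᶠ y in 𝓝 x, c ∈ t y := by
    intro x
    obtain ⟨η, hη, hηG⟩ := exists_pos_of_pos_on_graph (f := f) hι (G := G) (x₀ := x)
      (fun p hp => hG p (hp ▸ x.2)) (fun p hp => hpos p (hp ▸ x.2))
    obtain ⟨ρ, hρ, hρN⟩ := Metric.isOpen_iff.1 hN _ (hf x x.2)
    refine ⟨min η (ρ / 2), ?_⟩
    have h1 : ∀ᶠ y : N in 𝓝 x, dist (y : M) x < η :=
      continuous_subtype_val.continuousAt.eventually (Metric.ball_mem_nhds _ hη)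
    have h2 : ∀ᶠ y : N in 𝓝 x, dist (f y) (f x) < ρ / 2 :=
      (f.contMDiff.continuous.comp continuous_subtype_val).continuousAt.eventually
        (Metric.ball_mem_nhds _ (half_pos hρ))
    filter_upwards [h1, h2] with y hy1 hy2
    refine ⟨lt_min hη (half_pos hρ), fun z hz => hρN ?_, ?_⟩
    · have h3 : dist z (f y) < ρ / 2 := (Metric.mem_ball.1 hz).trans_le (min_le_right _ _)
      have := dist_triangle z (f y) (f x)
      exact Metric.mem_ball.2 (by linarith)
    · intro p hp hp1 r hr hr2
      exact hηG p (hp ▸ hy1) hp1 r (hr.trans_le (min_le_left _ _)) (hr2.trans_le (min_le_left _ _))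
  obtain ⟨g, hg⟩ := exists_continuous_forall_mem_convex_of_local_const ht hloc
  classical
  refine ⟨fun x => if hx : x ∈ N then g ⟨x, hx⟩ else 0, ?_, ?_⟩
  · rw [continuousOn_iff_continuous_domRestrict]
    refine g.continuous.congr fun x => ?_
    simp
  · intro x hx
    simp only [dif_pos hx]
    exact hg ⟨x, hx⟩

/-- What the cone fields require of a pair of tangent vectors, the second of which is close to
the image of the first under the derivative of `f`. -/
noncomputable def coneGap (f : M ≃ₘ^1⟮𝓘(ℝ, E), 𝓘(ℝ, E)⟯ M)
    (Es Eu : (x : M) → Submodule ℝ (TangentSpace 𝓘(ℝ, E) x)) (A : M → ℝ)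
    (p r : TangentBundle 𝓘(ℝ, E) M) : ℝ :=
  min
    (max (tnorm (tproj Es Eu p) - A p.1 * tnorm (tproj Eu Es p))
      (min (A r.1 * tnorm (tproj Eu Es r) - tnorm (tproj Es Eu r))
        (tnorm r ^ 2 * tnorm (tproj Eu Es p) -
          tnorm (tangentMap 𝓘(ℝ, E) 𝓘(ℝ, E) f (tproj Eu Es p)) * tnorm p ^ 2)))
    (max (tnorm (tproj Eu Es r) - A r.1 * tnorm (tproj Es Eu r))
      (min (A p.1 * tnorm (tproj Es Eu p) - tnorm (tproj Eu Es p))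
        (tnorm p ^ 2 * tnorm (tproj Es Eu r) -
          tnorm (tangentMap 𝓘(ℝ, E) 𝓘(ℝ, E) f.symm (tproj Es Eu r)) * tnorm r ^ 2)))

/-- In `coneGap` each maximum encodes an implication: either the vector lies outside the closed
cone, or its image lies strictly inside the next cone and is strictly expanded. Positivity of a
continuous function turns both implications into one open condition. -/
theorem continuousAt_coneGap (hA : ConeWidth f N Es Eu A) (h : HyperbolicSystem f N Es Eu)
    (hN : IsOpen N) {p r : TangentBundle 𝓘(ℝ, E) M} (hp : p.1 ∈ N) (hr : r.1 ∈ N) :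
    ContinuousAt (Function.uncurry (coneGap f Es Eu A)) (p, r) := by
  have hbase : Continuous fun p : TangentBundle 𝓘(ℝ, E) M => p.1 :=
    FiberBundle.continuous_proj E (fun x : M => TangentSpace 𝓘(ℝ, E) x)
  have cA : ∀ p : TangentBundle 𝓘(ℝ, E) M, p.1 ∈ N →
      ContinuousAt (fun p : TangentBundle 𝓘(ℝ, E) M => A p.1) p := fun p hp =>
    ContinuousAt.comp (hA.cont.continuousAt (hN.mem_nhds hp)) hbase.continuousAt
  have cs : ∀ p : TangentBundle 𝓘(ℝ, E) M, p.1 ∈ N →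
      ContinuousAt (fun p : TangentBundle 𝓘(ℝ, E) M => tnorm (tproj Es Eu p)) p := fun p hp =>
    ContinuousAt.comp (g := tnorm) continuous_tnorm.continuousAt (h.continuousAt_tproj_s hN hp)
  have cu : ∀ p : TangentBundle 𝓘(ℝ, E) M, p.1 ∈ N →
      ContinuousAt (fun p : TangentBundle 𝓘(ℝ, E) M => tnorm (tproj Eu Es p)) p := fun p hp =>
    ContinuousAt.comp (g := tnorm) continuous_tnorm.continuousAt (h.continuousAt_tproj_u hN hp)
  have cfu : ContinuousAt (fun p : TangentBundle 𝓘(ℝ, E) M =>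
      tnorm (tangentMap 𝓘(ℝ, E) 𝓘(ℝ, E) f (tproj Eu Es p))) p :=
    ContinuousAt.comp (g := tnorm ∘ tangentMap 𝓘(ℝ, E) 𝓘(ℝ, E) f)
      (continuous_tnorm.comp (continuous_tangentMap_diffeo f)).continuousAt
      (h.continuousAt_tproj_u hN hp)
  have cfs : ContinuousAt (fun p : TangentBundle 𝓘(ℝ, E) M =>
      tnorm (tangentMap 𝓘(ℝ, E) 𝓘(ℝ, E) f.symm (tproj Es Eu p))) r :=
    ContinuousAt.comp (g := tnorm ∘ tangentMap 𝓘(ℝ, E) 𝓘(ℝ, E) f.symm)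
      (continuous_tnorm.comp (continuous_tangentMap_diffeo f.symm)).continuousAt
      (h.continuousAt_tproj_s hN hr)
  have c1 : ∀ {F : TangentBundle 𝓘(ℝ, E) M → ℝ}, ContinuousAt F p →
      ContinuousAt (fun z : TangentBundle 𝓘(ℝ, E) M × TangentBundle 𝓘(ℝ, E) M => F z.1) (p, r) :=
    fun hF => ContinuousAt.comp (x := (p, r)) hF continuousAt_fst
  have c2 : ∀ {F : TangentBundle 𝓘(ℝ, E) M → ℝ}, ContinuousAt F r →
      ContinuousAt (fun z : TangentBundle 𝓘(ℝ, E) M × TangentBundle 𝓘(ℝ, E) M => F z.2) (p, r) :=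
    fun hF => ContinuousAt.comp (x := (p, r)) hF continuousAt_snd
  have n1 := c1 continuous_tnorm.continuousAt
  have n2 := c2 continuous_tnorm.continuousAt
  have e1 := c1 (cs p hp)
  have e2 := c1 (cu p hp)
  have e3 := c1 (cA p hp)
  have e4 := c2 (cs r hr)
  have e5 := c2 (cu r hr)
  have e6 := c2 (cA r hr)
  have e7 := c1 cfu
  have e8 := c2 cfs
  exact ((e1.sub (e3.mul e2)).max (((e6.mul e5).sub e4).min
    (((n2.pow 2).mul e2).sub (e7.mul (n1.pow 2))))).min
    ((e5.sub (e6.mul e4)).max (((e3.mul e1).sub e2).min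
      (((n1.pow 2).mul e4).sub (e8.mul (n2.pow 2)))))

theorem coneGap_pos (hA : ConeWidth f N Es Eu A) (h : HyperbolicSystem f N Es Eu)
    {p : TangentBundle 𝓘(ℝ, E) M} (hp : p.1 ∈ N) (hp1 : tnorm p ≠ 0) :
    0 < coneGap f Es Eu A p (tangentMap 𝓘(ℝ, E) 𝓘(ℝ, E) f p) := by
  have hfp := h.mapsTo _ hp
  set r := tangentMap 𝓘(ℝ, E) 𝓘(ℝ, E) f p with hr
  have hrp : tangentMap 𝓘(ℝ, E) 𝓘(ℝ, E) f.symm r = p := tangentMap_symm_tangentMap f p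
  have hr0 : tnorm r ≠ 0 := by
    intro h0
    apply hp1
    have h1 : r.2 = 0 := norm_eq_zero.1 h0
    rw [← hrp]
    unfold tnorm tangentMap
    rw [h1, map_zero, norm_zero]
  refine lt_min (lt_max_iff.2 ?_) (lt_max_iff.2 ?_)
  · by_cases hc : tnorm (tproj Es Eu p) ≤ A p.1 * tnorm (tproj Eu Es p)
    · have h1 := hA.strict h hp hp1 hc
      exact Or.inr (lt_min (sub_pos.2 h1.1) (sub_pos.2 h1.2))
    · exact Or.inl (sub_pos.2 (not_le.1 hc))
  · by_cases hc : tnorm (tproj Eu Es r) ≤ A r.1 * tnorm (tproj Es Eu r)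
    · have h1 := (hA.symm h).strict h.symm (p := r) hfp hr0 hc
      have h2 : f.symm r.1 = p.1 := congrArg (fun z : TangentBundle 𝓘(ℝ, E) M => z.1) hrp
      rw [hrp, h2] at h1
      exact Or.inr (lt_min (sub_pos.2 h1.1) (sub_pos.2 h1.2))
    · exact Or.inl (sub_pos.2 (not_le.1 hc))

end Cones

/-! ### The truncated distance to the boundary. -/

section TruncatedDistance

variable {M : Type*} [MetricSpace M]

/-- The distance to the boundary of `N`, truncated at `r`. -/
noncomputable def truncDist (N : Set M) (r : ℝ) (x : M) : ℝ :=
  (min (ENNReal.ofReal r) (bdryEDist N x)).toReal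

variable {N : Set M} {r : ℝ}

theorem min_ofReal_bdryEDist_ne_top (N : Set M) (r : ℝ) (x : M) :
    min (ENNReal.ofReal r) (bdryEDist N x) ≠ ⊤ :=
  ((min_le_left _ _).trans_lt ENNReal.ofReal_lt_top).ne

theorem continuous_truncDist : Continuous (truncDist N r) := by
  rw [continuous_iff_continuousAt]
  intro x
  refine (ENNReal.continuousAt_toReal (min_ofReal_bdryEDist_ne_top N r x)).comp
    (f := fun x => min (ENNReal.ofReal r) (bdryEDist N x)) ?_
  exact (continuous_const.min Metric.continuous_infEDist).continuousAt

theorem truncDist_le (hr : 0 ≤ r) (x : M) : truncDist N r x ≤ r :=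
  ENNReal.toReal_le_of_le_ofReal hr (min_le_left _ _)

theorem bdryEDist_pos (hN : IsOpen N) {x : M} (hx : x ∈ N) : 0 < bdryEDist N x := by
  rw [pos_iff_ne_zero]
  intro h0
  rcases (frontier N).eq_empty_or_nonempty with he | he
  · simp [bdryEDist, he] at h0
  · have h1 := (Metric.mem_iff_infEDist_zero_of_closed isClosed_frontier).2 h0
    rw [hN.frontier_eq] at h1
    exact h1.2 hx

theorem truncDist_pos (hN : IsOpen N) (hr : 0 < r) {x : M} (hx : x ∈ N) : 0 < truncDist N r x :=
  ENNReal.toReal_pos (lt_min (ENNReal.ofReal_pos.2 hr) (bdryEDist_pos hN hx)).ne'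
    (min_ofReal_bdryEDist_ne_top N r x)

theorem truncDist_eq_zero {x : M} (hx : x ∈ frontier N) : truncDist N r x = 0 := by
  have h1 : bdryEDist N x = 0 := Metric.infEDist_zero_of_mem hx
  simp [truncDist, h1]

theorem bdryEDist_lt_of_truncDist_lt {x : M} (h : truncDist N r x < r) :
    bdryEDist N x < ENNReal.ofReal r := by
  by_contra hcon
  rw [truncDist, min_eq_left (not_lt.1 hcon), ENNReal.toReal_ofReal'] at h
  exact absurd h (not_lt.2 (le_max_left _ _))

theorem truncDist_eq_bdryDist {x : M} (h : truncDist N r x < r) :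
    truncDist N r x = bdryDist N x := by
  rw [truncDist, min_eq_right (bdryEDist_lt_of_truncDist_lt h).le, bdryDist]

theorem truncDist_le_bdryDist (hN : (frontier N).Nonempty) (x : M) :
    truncDist N r x ≤ bdryDist N x :=
  ENNReal.toReal_mono (Metric.infEDist_ne_top hN) (min_le_right _ _)

end TruncatedDistance

/-! ### Construction of the cone width from the rate assumptions. -/

section Widths

variable {E : Type*} [NormedAddCommGroup E] [NormedSpace ℝ E] [FiniteDimensional ℝ E]
  {M : Type*} [MetricSpace M] [CompactSpace M] [ChartedSpace E M] [IsManifold 𝓘(ℝ, E) ∞ M]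
  [RiemannianBundle (fun x : M => TangentSpace 𝓘(ℝ, E) x)]
  [IsContMDiffRiemannianBundle 𝓘(ℝ, E) ∞ E (fun x : M => TangentSpace 𝓘(ℝ, E) x)]
  {f : M ≃ₘ^1⟮𝓘(ℝ, E), 𝓘(ℝ, E)⟯ M} {N : Set M}
  {Es Eu : (x : M) → Submodule ℝ (TangentSpace 𝓘(ℝ, E) x)} {r : ℝ}

/-- The points of `N` at truncated distance `r` from the boundary cannot accumulate on it, so
compactness and closedness of `Eu` give a uniform excess over 1. -/
theorem HyperbolicSystem.exists_uniform_expansion (h : HyperbolicSystem f N Es Eu)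
    (hr : 0 < r) : ∃ κ > 0, ∀ x ∈ N, r ≤ truncDist N r x → 1 + κ ≤ minOn f Eu x := by
  by_contra hcon
  push Not at hcon
  choose x hxN hxr hxm using fun n : ℕ => hcon (1 / (n + 1)) Nat.one_div_pos_of_nat
  choose e heu he1 hefx using fun n => exists_unit_lt_of_minNorm_lt
    (mfderiv 𝓘(ℝ, E) 𝓘(ℝ, E) f (x n)) (Eu (x n)) (h.ne_bot (hxN n)) (hxm n)
  have hU : (hyperfilter ℕ : Filter ℕ) ≤ atTop := by
    rw [← Nat.cofinite_eq_atTop]; exact hyperfilter_le_cofinite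
  obtain ⟨x₀, -, hx₀⟩ := isCompact_univ.ultrafilter_le_nhds ((hyperfilter ℕ).map x) (by simp)
  have hb : Tendsto x (hyperfilter ℕ : Filter ℕ) (𝓝 x₀) := hx₀
  have hr₀ : r ≤ truncDist N r x₀ := ge_of_tendsto ((continuous_truncDist.tendsto x₀).comp hb)
    (Eventually.of_forall hxr)
  have hx₀N : x₀ ∈ N := by
    by_contra hn
    have hcl : x₀ ∈ closure N := mem_closure_of_tendsto hb (Eventually.of_forall hxN)
    have hfr : x₀ ∈ frontier N := ⟨hcl, fun hi => hn (interior_subset hi)⟩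
    rw [truncDist_eq_zero hfr] at hr₀
    linarith
  obtain ⟨v, hv⟩ := exists_tendsto_totalSpace (F := E)
    (V := fun x : M => TangentSpace 𝓘(ℝ, E) x) (hyperfilter ℕ) hb (v := e) (C := 1)
    (Eventually.of_forall fun n => (he1 n).le)
  have hv1 : tnorm (⟨x₀, v⟩ : TangentBundle 𝓘(ℝ, E) M) = 1 :=
    tendsto_nhds_unique ((continuous_tnorm.tendsto _).comp hv)
      (tendsto_const_nhds.congr fun n => (he1 n).symm)
  have hvu : v ∈ Eu x₀ := h.closed_u ⟨x₀, v⟩ hx₀N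
    (mem_closure_of_tendsto hv (Eventually.of_forall fun n => ⟨hxN n, heu n⟩))
  have hlim : Tendsto (fun n : ℕ => 1 + 1 / ((n : ℝ) + 1)) (hyperfilter ℕ : Filter ℕ)
      (𝓝 (1 + 0)) :=
    (tendsto_const_nhds.add tendsto_one_div_add_atTop_nhds_zero_nat).mono_left hU
  have hle : tnorm (tangentMap 𝓘(ℝ, E) 𝓘(ℝ, E) f ⟨x₀, v⟩) ≤ 1 + 0 :=
    le_of_tendsto_of_tendsto
      (((continuous_tnorm.comp (continuous_tangentMap_diffeo f)).tendsto _).comp hv) hlim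
      (Eventually.of_forall fun n => (hefx n).le)
  have h1 := h.expand_u (p := ⟨x₀, v⟩) hvu
  rw [hv1] at h1
  have h2 := h.one_lt_u x₀ hx₀N
  have h3 : minOn f Eu x₀ * 1 ≤ 1 + 0 := h1.trans hle
  linarith

variable {c : RateConsts} {α γ : ℝ}

theorem HyperbolicSystem.exists_expansion_ge (h : HyperbolicSystem f N Es Eu) (hN : IsOpen N)
    (hr : 0 < r) (hrc : r ≤ c.r₀) (hc : c.Admissible α) (hβγ : c.β ≤ γ)
    (hrate : ∀ x ∈ N, bdryEDist N x ≤ ENNReal.ofReal c.r₀ →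
      c.C * max (bdryDist N x ^ c.β) ((bdryDist N (f x) / bdryDist N x) ^ c.γ - 1)
        ≤ minOn f Eu x - 1) :
    ∃ κ > 0, ∀ x ∈ N, 1 + κ * truncDist N r x ^ γ ≤ minOn f Eu x := by
  obtain ⟨κ, hκ, hκN⟩ := h.exists_uniform_expansion hr
  have hrγ : 0 < r ^ γ := Real.rpow_pos_of_pos hr γ
  -- The first constant serves where `D = r`; the second serves where `D < r`, since there `D ^ β =
  -- D ^ (β - γ) * D ^ γ ≥ r ^ (β - γ) * D ^ γ` because `β ≤ γ`.
  refine ⟨min (κ / r ^ γ) (r ^ (c.β - γ)), lt_min (by positivity) (Real.rpow_pos_of_pos hr _), ?_⟩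
  intro x hx
  have hD := truncDist_pos hN hr hx
  have hDr := truncDist_le (N := N) hr.le x
  have hDγ : 0 < truncDist N r x ^ γ := Real.rpow_pos_of_pos hD γ
  rcases hDr.eq_or_lt with heq | hlt
  · have h1 := hκN x hx heq.ge
    rw [heq]
    have h2 : min (κ / r ^ γ) (r ^ (c.β - γ)) * r ^ γ ≤ κ / r ^ γ * r ^ γ := by
      gcongr; exact min_le_left _ _
    rw [div_mul_cancel₀ _ hrγ.ne'] at h2
    linarith
  · have hed : bdryEDist N x ≤ ENNReal.ofReal c.r₀ :=
      (bdryEDist_lt_of_truncDist_lt hlt).le.trans (ENNReal.ofReal_le_ofReal hrc)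
    have h1 := hrate x hx hed
    rw [← truncDist_eq_bdryDist hlt] at h1
    have hDβ : 0 < truncDist N r x ^ c.β := Real.rpow_pos_of_pos hD _
    have h2 : truncDist N r x ^ c.β ≤ minOn f Eu x - 1 := by
      refine le_trans ?_ h1
      refine le_trans (le_max_left _ _) (le_mul_of_one_le_left ?_ hc.2.2.2.le)
      exact hDβ.le.trans (le_max_left _ _)
    have h3 : min (κ / r ^ γ) (r ^ (c.β - γ)) * truncDist N r x ^ γ ≤ truncDist N r x ^ c.β :=
      calc min (κ / r ^ γ) (r ^ (c.β - γ)) * truncDist N r x ^ γ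
          ≤ r ^ (c.β - γ) * truncDist N r x ^ γ := by gcongr; exact min_le_right _ _
        _ ≤ truncDist N r x ^ (c.β - γ) * truncDist N r x ^ γ := by
            exact mul_le_mul_of_nonneg_right
              (Real.rpow_le_rpow_of_nonpos hD hDr (by linarith)) hDγ.le
        _ = truncDist N r x ^ c.β := by rw [← Real.rpow_add hD, sub_add_cancel]
    linarith

/-- Only an increase of the distance needs an argument. It can occur only where `D < r`, and there
the ratio term of the rate assumption bounds it. -/
theorem HyperbolicSystem.truncDist_rpow_map_le (h : HyperbolicSystem f N Es Eu) (hN : IsOpen N)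
    (hr : 0 < r) (hrc : r ≤ c.r₀) (hc : c.Admissible α) (hγ : 0 < γ) (hγγ : γ ≤ c.γ)
    (hrate : ∀ x ∈ N, bdryEDist N x ≤ ENNReal.ofReal c.r₀ →
      c.C * max (bdryDist N x ^ c.β) ((bdryDist N (f x) / bdryDist N x) ^ c.γ - 1)
        ≤ minOn f Eu x - 1) {x : M} (hx : x ∈ N) :
    truncDist N r (f x) ^ γ ≤ minOn f Eu x * truncDist N r x ^ γ := by
  have hD := truncDist_pos hN hr hx
  have hDf := truncDist_pos hN hr (h.mapsTo x hx)
  have hDγ : 0 < truncDist N r x ^ γ := Real.rpow_pos_of_pos hD γ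
  rcases le_or_gt (truncDist N r (f x)) (truncDist N r x) with hle | hlt
  · calc truncDist N r (f x) ^ γ ≤ truncDist N r x ^ γ := by gcongr
      _ ≤ minOn f Eu x * truncDist N r x ^ γ :=
        le_mul_of_one_le_left hDγ.le (h.one_lt_u x hx).le
  · have hlt' := hlt.trans_le (truncDist_le (N := N) hr.le (f x))
    have hed := bdryEDist_lt_of_truncDist_lt hlt'
    have hne : (frontier N).Nonempty := by
      by_contra hcon
      rw [bdryEDist, not_nonempty_iff_eq_empty.1 hcon, Metric.infEDist_empty] at hed
      exact not_top_lt hed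
    have h1 := hrate x hx (hed.le.trans (ENNReal.ofReal_le_ofReal hrc))
    rw [← truncDist_eq_bdryDist hlt'] at h1
    have hratio : 1 ≤ truncDist N r (f x) / truncDist N r x := by
      rw [one_le_div hD]; exact hlt.le
    have hγ0 : 0 ≤ c.γ := hγ.le.trans hγγ
    have h2 : (truncDist N r (f x) / truncDist N r x) ^ γ ≤
        (bdryDist N (f x) / truncDist N r x) ^ c.γ :=
      calc (truncDist N r (f x) / truncDist N r x) ^ γ
          ≤ (truncDist N r (f x) / truncDist N r x) ^ c.γ :=
            Real.rpow_le_rpow_of_exponent_le hratio hγγ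
        _ ≤ (bdryDist N (f x) / truncDist N r x) ^ c.γ := by
            gcongr
            exact truncDist_le_bdryDist hne (f x)
    have h3 : (bdryDist N (f x) / truncDist N r x) ^ c.γ - 1 ≤ minOn f Eu x - 1 := by
      refine le_trans ?_ h1
      refine le_trans (le_max_right _ _) (le_mul_of_one_le_left ?_ hc.2.2.2.le)
      exact (Real.rpow_nonneg hD.le _).trans (le_max_left _ _)
    have h4 : (truncDist N r (f x) / truncDist N r x) ^ γ ≤ minOn f Eu x := by linarith
    rw [Real.div_rpow hDf.le hD.le, div_le_iff₀ hDγ] at h4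
    exact h4

/-- As `(1 + t / 3) ^ 2 ≤ 1 + t` for `t ≤ 1`, the right side is at least `t / 6`. -/
theorem div_seven_lt_of_one_add_le {t m : ℝ} (ht : 0 < t) (ht1 : t ≤ 1) (h : 1 + t ≤ m) :
    t / 7 < (√m - 1) / 2 := by
  have h1 : 1 + t / 3 ≤ √m := by
    refine Real.le_sqrt_of_sq_le (le_trans ?_ h)
    nlinarith
  linarith

/-- A power of the truncated distance to the boundary is an admissible width of the cones. -/
theorem HyperbolicSystem.exists_coneWidth (h : HyperbolicSystem f N Es Eu) (hN : IsOpen N)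
    {cu cs : RateConsts} (hα : α ≤ 1)
    (hcu : cu.Admissible α) (hcs : cs.Admissible α) (hR : AssumptionR α cu cs)
    (hU : ∀ x ∈ N, bdryEDist N x ≤ ENNReal.ofReal cu.r₀ →
      cu.C * max (bdryDist N x ^ cu.β) ((bdryDist N (f x) / bdryDist N x) ^ cu.γ - 1)
        ≤ minOn f Eu x - 1)
    (hS : ∀ x ∈ N, bdryEDist N x ≤ ENNReal.ofReal cs.r₀ →
      cs.C * max (bdryDist N x ^ cs.β) ((bdryDist N (f.symm x) / bdryDist N x) ^ cs.γ - 1)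
        ≤ minOn f.symm Es x - 1) :
    ∃ A : M → ℝ, ConeWidth f N Es Eu A := by
  set r := rMin cu cs with hr_def
  set γ := gammaMin cu cs with hγ_def
  have hr : 0 < r := lt_min hcu.1 hcs.1
  have hγ : 0 < γ := by
    have h1 : 1 < cu.γ := (le_max_left _ _).trans_lt hcu.2.2.1
    have h2 : 1 < cs.γ := (le_max_left _ _).trans_lt hcs.2.2.1
    exact zero_lt_one.trans (lt_min h2 h1)
  have hβγ : betaMax cu cs ≤ γ := by
    have h1 : betaMax cu cs / γ ≤ 1 := (show betaMax cu cs / γ < α from hR).le.trans hα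
    rwa [div_le_one hγ] at h1
  obtain ⟨κu, hκu, hmu⟩ := h.exists_expansion_ge hN hr (min_le_left _ _) hcu
    ((le_max_right _ _).trans hβγ) hU
  obtain ⟨κs, hκs, hms⟩ := h.symm.exists_expansion_ge hN hr (min_le_right _ _) hcs
    ((le_max_left _ _).trans hβγ) hS
  have hrγ : 0 < (r ^ γ)⁻¹ := inv_pos.2 (Real.rpow_pos_of_pos hr γ)
  -- The last term ensures `κ * D ^ γ ≤ 1`, which the comparison with the square roots requires.
  set κ := min (min κu κs) (r ^ γ)⁻¹ with hκ_def
  have hκ : 0 < κ := lt_min (lt_min hκu hκs) hrγ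
  have hD : ∀ x ∈ N, 0 < truncDist N r x ^ γ := fun x hx =>
    Real.rpow_pos_of_pos (truncDist_pos hN hr hx) γ
  have ht1 : ∀ x ∈ N, κ * truncDist N r x ^ γ ≤ 1 := by
    intro x hx
    calc κ * truncDist N r x ^ γ ≤ (r ^ γ)⁻¹ * r ^ γ := by
          have h1 := truncDist_pos hN hr hx
          have h2 := truncDist_le (N := N) hr.le x
          have h3 := min_le_right (min κu κs) (r ^ γ)⁻¹
          gcongr
      _ = 1 := inv_mul_cancel₀ (Real.rpow_pos_of_pos hr γ).ne'
  have hu1 := h.one_lt_u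
  have hs1 := h.one_lt_s
  have hstep_u : ∀ x ∈ N, truncDist N r (f x) ^ γ ≤ minOn f Eu x * truncDist N r x ^ γ :=
    fun x hx => h.truncDist_rpow_map_le hN hr (min_le_left _ _) hcu hγ (min_le_right _ _) hU hx
  have hstep_s : ∀ x ∈ N, truncDist N r x ^ γ ≤
      minOn f.symm Es (f x) * truncDist N r (f x) ^ γ := by
    intro x hx
    have h1 := h.symm.truncDist_rpow_map_le hN hr (min_le_right _ _) hcs hγ (min_le_left _ _) hS
      (h.mapsTo x hx)
    rwa [show f.symm (f x) = x from f.symm_apply_apply x] at h1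
  refine ⟨fun x => κ * truncDist N r x ^ γ / 7, ?_, ?_, ?_, ?_, ?_, ?_, ?_⟩
  · intro x hx
    have := hD x hx
    positivity
  · intro x hx
    have := ht1 x hx
    linarith
  · refine Continuous.continuousOn ?_
    exact (continuous_const.mul
      (continuous_truncDist.rpow_const fun x => Or.inr hγ.le)).div_const 7
  · intro x hx
    have hfx := h.mapsTo x hx
    have h1 := hstep_s x hx
    have h2 := hu1 x hx
    have h3 := hD x hx
    calc κ * truncDist N r x ^ γ / 7 < minOn f Eu x * (κ * truncDist N r x ^ γ / 7) :=
          lt_mul_of_one_lt_left (by positivity) h2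
      _ ≤ minOn f Eu x * (κ * (minOn f.symm Es (f x) * truncDist N r (f x) ^ γ) / 7) := by
          gcongr
      _ = _ := by ring
  · intro x hx
    have hfx := h.mapsTo x hx
    have h1 := hstep_u x hx
    have h2 := hs1 _ hfx
    have h3 := hD _ hfx
    calc κ * truncDist N r (f x) ^ γ / 7
        < minOn f.symm Es (f x) * (κ * truncDist N r (f x) ^ γ / 7) :=
          lt_mul_of_one_lt_left (by positivity) h2
      _ ≤ minOn f.symm Es (f x) * (κ * (minOn f Eu x * truncDist N r x ^ γ) / 7) := by
          gcongr
      _ = _ := by ring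
  · intro x hx
    have h3 := hD x hx
    refine div_seven_lt_of_one_add_le (by positivity) (ht1 x hx) (le_trans ?_ (hmu x hx))
    have : κ ≤ κu := (min_le_left _ _).trans (min_le_left _ _)
    gcongr
  · intro x hx
    have h3 := hD x hx
    refine div_seven_lt_of_one_add_le (by positivity) (ht1 x hx) (le_trans ?_ (hms x hx))
    have : κ ≤ κs := (min_le_left _ _).trans (min_le_right _ _)
    gcongr

end Widths

/-! ### Invariant subspaces of a linear cocycle with invariant cones. -/

section ConeFields

variable {X : Type*} {V : X → Type*} [∀ x, NormedAddCommGroup (V x)]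
  [∀ x, NormedSpace ℝ (V x)]

/-- The closed cone of width `a` around `S`, with respect to the complement `T` of `S`. -/
def coneAround {W : Type*} [NormedAddCommGroup W] [NormedSpace ℝ W] (S T : Submodule ℝ W) (a : ℝ) :
    Set W :=
  {v | ‖projAlong T S v‖ ≤ a * ‖projAlong S T v‖}

/-- The cocycle over the iterates of `h` generated by `D`. -/
def iterMap (h : X → X) (D : ∀ x, V x →L[ℝ] V (h x)) : (n : ℕ) → (x : X) → V x →L[ℝ] V (h^[n] x)
  | 0, x => ContinuousLinearMap.id ℝ (V x)
  | n + 1, x => (iterMap h D n (h x)).comp (D x)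

/-- The vectors with bounded forward orbit. -/
def boundedOrbits (h : X → X) (D : ∀ x, V x →L[ℝ] V (h x)) (x : X) : Submodule ℝ (V x) where
  carrier := {v | ∃ C : ℝ, ∀ n, ‖iterMap h D n x v‖ ≤ C}
  add_mem' := by
    rintro v w ⟨C, hC⟩ ⟨C', hC'⟩
    refine ⟨C + C', fun n => ?_⟩
    rw [map_add]
    exact (norm_add_le _ _).trans (add_le_add (hC n) (hC' n))
  zero_mem' := ⟨0, fun n => by simp⟩
  smul_mem' := by
    rintro c v ⟨C, hC⟩
    refine ⟨‖c‖ * C, fun n => ?_⟩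
    rw [map_smul, norm_smul]
    exact mul_le_mul_of_nonneg_left (hC n) (norm_nonneg c)

theorem map_mem_boundedOrbits {h : X → X} {D : ∀ x, V x →L[ℝ] V (h x)} {x : X} {v : V x} :
    D x v ∈ boundedOrbits h D (h x) ↔ v ∈ boundedOrbits h D x := by
  constructor
  · rintro ⟨C, hC⟩
    refine ⟨max C ‖v‖, fun n => ?_⟩
    cases n with
    | zero => exact le_max_right _ _
    | succ n => exact (hC n).trans (le_max_left _ _)
  · rintro ⟨C, hC⟩
    exact ⟨C, fun n => hC (n + 1)⟩

/-- A linear cocycle with two invariant cone fields around the subspaces of a splitting, where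
the vectors of one cone grow beyond all bounds. -/
structure ConeSystem (h : X → X) (D : ∀ x, V x →L[ℝ] V (h x)) (N : Set X)
    (Ec Ee : ∀ x, Submodule ℝ (V x)) (A m : X → ℝ) : Prop where
  mapsTo : ∀ x ∈ N, h x ∈ N
  isCompl : ∀ x ∈ N, IsCompl (Ec x) (Ee x)
  finrank_fiber : ∀ x ∈ N, ∀ y ∈ N, Module.finrank ℝ (V x) = Module.finrank ℝ (V y)
  finrank_eq : ∀ x ∈ N, ∀ y ∈ N, Module.finrank ℝ (Ec x) = Module.finrank ℝ (Ec y)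
  width_pos : ∀ x ∈ N, 0 < A x
  width_lt_one : ∀ x ∈ N, A x < 1
  one_le : ∀ x ∈ N, 1 ≤ m x
  prod : ∀ x ∈ N, ProdDiverges fun i => m (h^[i] x)
  forward : ∀ x ∈ N, ∀ v ∈ coneAround (Ee x) (Ec x) (A x),
    D x v ∈ coneAround (Ee (h x)) (Ec (h x)) (A (h x)) ∧ m x * ‖v‖ ^ 2 ≤ ‖D x v‖ ^ 2
  backward : ∀ x ∈ N, ∀ v, D x v ∈ coneAround (Ec (h x)) (Ee (h x)) (A (h x)) →
    v ∈ coneAround (Ec x) (Ee x) (A x) ∧ ‖D x v‖ ≤ ‖v‖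

theorem mem_coneAround_of_mem {W : Type*} [NormedAddCommGroup W] [NormedSpace ℝ W]
    {S T : Submodule ℝ W} (hST : IsCompl S T) {a : ℝ} (ha : 0 ≤ a) {v : W} (hv : v ∈ S) :
    v ∈ coneAround S T a := by
  change ‖projAlong T S v‖ ≤ a * ‖projAlong S T v‖
  rw [projAlong_of_mem_right hST.symm hv, norm_zero]
  positivity

theorem eq_zero_of_mem_coneAround {W : Type*} [NormedAddCommGroup W] [NormedSpace ℝ W]
    {S T : Submodule ℝ W} (hST : IsCompl S T) {a : ℝ} (ha : 0 ≤ a) (ha1 : a < 1) {v : W}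
    (h1 : v ∈ coneAround S T a) (h2 : v ∈ coneAround T S a) : v = 0 := by
  have h1' : ‖projAlong T S v‖ ≤ a * ‖projAlong S T v‖ := h1
  have h2' : ‖projAlong S T v‖ ≤ a * ‖projAlong T S v‖ := h2
  have hs := norm_nonneg (projAlong S T v)
  have ht := norm_nonneg (projAlong T S v)
  have h3 : ‖projAlong S T v‖ = 0 := by nlinarith
  have h4 : ‖projAlong T S v‖ = 0 := by nlinarith
  rw [← projAlong_add hST v, norm_eq_zero.1 h3, norm_eq_zero.1 h4, add_zero]

theorem isClosed_coneAround {W : Type*} [NormedAddCommGroup W] [NormedSpace ℝ W]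
    [FiniteDimensional ℝ W] (S T : Submodule ℝ W) (a : ℝ) : IsClosed (coneAround S T a) :=
  isClosed_le (projAlong T S).continuous_of_finiteDimensional.norm
    (continuous_const.mul (projAlong S T).continuous_of_finiteDimensional.norm)

namespace ConeSystem

variable {h : X → X} {D : ∀ x, V x →L[ℝ] V (h x)} {N : Set X}
  {Ec Ee : ∀ x, Submodule ℝ (V x)} {A m : X → ℝ}

theorem iterMap_forward (H : ConeSystem h D N Ec Ee A m) (n : ℕ) :
    ∀ x ∈ N, ∀ v ∈ coneAround (Ee x) (Ec x) (A x),
      iterMap h D n x v ∈ coneAround (Ee (h^[n] x)) (Ec (h^[n] x)) (A (h^[n] x)) ∧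
        (∏ i ∈ Finset.range n, m (h^[i] x)) * ‖v‖ ^ 2 ≤ ‖iterMap h D n x v‖ ^ 2 := by
  induction n with
  | zero =>
    intro x _ v hv
    refine ⟨hv, ?_⟩
    rw [Finset.prod_range_zero, one_mul]
    exact le_rfl
  | succ n ih =>
    intro x hx v hv
    obtain ⟨h1, h2⟩ := H.forward x hx v hv
    obtain ⟨h3, h4⟩ := ih (h x) (H.mapsTo x hx) _ h1
    refine ⟨h3, le_trans ?_ h4⟩
    rw [Finset.prod_range_succ', mul_assoc]
    refine mul_le_mul_of_nonneg_left h2 (Finset.prod_nonneg fun i _ => ?_)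
    have hi : h^[i] (h x) ∈ N := (show MapsTo h N N from H.mapsTo).iterate i (H.mapsTo _ hx)
    exact zero_le_one.trans (H.one_le _ hi)

theorem iterMap_backward (H : ConeSystem h D N Ec Ee A m) (n : ℕ) :
    ∀ x ∈ N, ∀ v, iterMap h D n x v ∈ coneAround (Ec (h^[n] x)) (Ee (h^[n] x)) (A (h^[n] x)) →
      v ∈ coneAround (Ec x) (Ee x) (A x) ∧ ∀ j ≤ n, ‖iterMap h D j x v‖ ≤ ‖v‖ := by
  induction n with
  | zero =>
    intro x _ v hv
    refine ⟨hv, fun j hj => ?_⟩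
    rw [Nat.le_zero.1 hj]
    exact le_rfl
  | succ n ih =>
    intro x hx v hv
    obtain ⟨h1, h2⟩ := ih (h x) (H.mapsTo x hx) (D x v) hv
    obtain ⟨h3, h4⟩ := H.backward x hx v h1
    refine ⟨h3, fun j hj => ?_⟩
    cases j with
    | zero => exact le_rfl
    | succ j => exact (h2 j (Nat.succ_le_succ_iff.1 hj)).trans h4

theorem one_le_prod (H : ConeSystem h D N Ec Ee A m) (n : ℕ) {x : X} (hx : x ∈ N) :
    1 ≤ ∏ i ∈ Finset.range n, m (h^[i] x) := by
  induction n with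
  | zero => simp
  | succ n ih =>
    rw [Finset.prod_range_succ]
    exact one_le_mul_of_one_le_of_one_le ih
      (H.one_le _ ((show MapsTo h N N from H.mapsTo).iterate n hx))

theorem eq_zero_of_mem_boundedOrbits (H : ConeSystem h D N Ec Ee A m) {x : X} (hx : x ∈ N)
    {v : V x} (hv : v ∈ coneAround (Ee x) (Ec x) (A x)) (hb : v ∈ boundedOrbits h D x) :
    v = 0 := by
  by_contra h0
  obtain ⟨C, hC⟩ := hb
  have hn : 0 < ‖v‖ ^ 2 := by have := norm_pos_iff.2 h0; positivity
  obtain ⟨n, hn'⟩ := ((H.prod x hx).eventually_gt_atTop (C ^ 2 / ‖v‖ ^ 2)).exists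
  rw [div_lt_iff₀ hn] at hn'
  have h1 := (H.iterMap_forward n x hx v hv).2
  have h2 : ‖iterMap h D n x v‖ ^ 2 ≤ C ^ 2 := by gcongr; exact hC n
  linarith

variable [∀ x, FiniteDimensional ℝ (V x)]

/-- The `n`-th image of `Ee x` has full dimension and stays in the expanding cone, so it is a
complement of `Ec` at the endpoint. Subtracting from `c` a vector of `Ee x` therefore moves its
`n`-th image into `Ec`. -/
theorem exists_iterMap_mem (H : ConeSystem h D N Ec Ee A m) {x : X} (hx : x ∈ N) (c : V x)
    (n : ℕ) : ∃ φ : V x, c - φ ∈ Ee x ∧ iterMap h D n x φ ∈ Ec (h^[n] x) := by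
  have hy : h^[n] x ∈ N := (show MapsTo h N N from H.mapsTo).iterate n hx
  have hcone : ∀ v ∈ Ee x, v ∈ coneAround (Ee x) (Ec x) (A x) := fun v hv =>
    mem_coneAround_of_mem (H.isCompl x hx).symm (H.width_pos x hx).le hv
  let L : V x →ₗ[ℝ] V (h^[n] x) := (iterMap h D n x).toLinearMap
  have hinj : Function.Injective (L.domRestrict (Ee x)) := by
    rw [injective_iff_map_eq_zero]
    rintro ⟨v, hv⟩ hv0
    have h1 := (H.iterMap_forward n x hx v (hcone v hv)).2
    have h2 : iterMap h D n x v = 0 := hv0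
    rw [h2, norm_zero] at h1
    have h3 := H.one_le_prod n hx
    have h4 : ‖v‖ ^ 2 ≤ 0 := by nlinarith [sq_nonneg ‖v‖]
    have h5 : v = 0 := by simpa using le_antisymm h4 (sq_nonneg _)
    simpa using h5
  have hrange : LinearMap.range (L.domRestrict (Ee x)) = (Ee x).map L :=
    LinearMap.range_domRestrict _ _
  have hdim : Module.finrank ℝ ((Ee x).map L) = Module.finrank ℝ (Ee x) := by
    rw [← hrange]; exact LinearMap.finrank_range_of_inj hinj
  have hdisj : Disjoint ((Ee x).map L) (Ec (h^[n] x)) := by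
    rw [Submodule.disjoint_def]
    rintro w ⟨v, hv, rfl⟩ hw
    exact eq_zero_of_mem_coneAround (H.isCompl _ hy) (H.width_pos _ hy).le (H.width_lt_one _ hy)
      (mem_coneAround_of_mem (H.isCompl _ hy) (H.width_pos _ hy).le hw)
      (H.iterMap_forward n x hx v (hcone v hv)).1
  have htop : (Ee x).map L ⊔ Ec (h^[n] x) = ⊤ := by
    refine Submodule.eq_top_of_disjoint _ _ ?_ hdisj
    rw [hdim, H.finrank_eq _ hy x hx, H.finrank_fiber _ hy x hx, add_comm]
    exact (Submodule.finrank_add_eq_of_isCompl (H.isCompl x hx)).ge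
  obtain ⟨_, ⟨e, he, rfl⟩, w, hw, hew⟩ := Submodule.mem_sup.1
    (htop ▸ Submodule.mem_top : iterMap h D n x c ∈ (Ee x).map L ⊔ Ec (h^[n] x))
  refine ⟨c - e, by simpa using he, ?_⟩
  have h1 : iterMap h D n x (c - e) = w := by
    rw [map_sub, ← hew]
    exact add_sub_cancel_left _ _
  rw [h1]
  exact hw

/-- The vectors `φ n` that reach `Ec` at time `n` have norms nonincreasing relative to time 0 up to
then, by backward invariance of the cones. A limit as `n` grows has bounded orbit for all time. -/
theorem exists_mem_boundedOrbits (H : ConeSystem h D N Ec Ee A m) {x : X} (hx : x ∈ N) (c : V x) :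
    ∃ φ : V x, c - φ ∈ Ee x ∧ φ ∈ boundedOrbits h D x ∧ φ ∈ coneAround (Ec x) (Ee x) (A x) := by
  choose φ hφ hφn using H.exists_iterMap_mem hx c
  have hN : ∀ n, h^[n] x ∈ N := fun n => (show MapsTo h N N from H.mapsTo).iterate n hx
  have hback : ∀ n, φ n ∈ coneAround (Ec x) (Ee x) (A x) ∧
      ∀ j ≤ n, ‖iterMap h D j x (φ n)‖ ≤ ‖φ n‖ := fun n =>
    H.iterMap_backward n x hx _
      (mem_coneAround_of_mem (H.isCompl _ (hN n)) (H.width_pos _ (hN n)).le (hφn n))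
  -- All `φ n` have the same component in `Ec x` as `c`, and their other component is no larger
  -- because the width is below 1.
  set K := 2 * ‖projAlong (Ec x) (Ee x) c‖ with hK
  have hbd : ∀ n, ‖φ n‖ ≤ K := by
    intro n
    have h1 : projAlong (Ec x) (Ee x) (φ n) = projAlong (Ec x) (Ee x) c := by
      have := projAlong_of_mem_right (H.isCompl x hx) (hφ n)
      rw [map_sub, sub_eq_zero] at this
      exact this.symm
    have h2 : ‖projAlong (Ee x) (Ec x) (φ n)‖ ≤ A x * ‖projAlong (Ec x) (Ee x) (φ n)‖ :=
      (hback n).1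
    have h3 := norm_add_le (projAlong (Ec x) (Ee x) (φ n)) (projAlong (Ee x) (Ec x) (φ n))
    rw [projAlong_add (H.isCompl x hx)] at h3
    rw [h1] at h2 h3
    have h4 := H.width_lt_one x hx
    have h5 := norm_nonneg (projAlong (Ec x) (Ee x) c)
    nlinarith
  have : ProperSpace (V x) := FiniteDimensional.proper ℝ (V x)
  obtain ⟨ψ, -, hψ⟩ := (isCompact_closedBall (0 : V x) K).ultrafilter_le_nhds
    ((hyperfilter ℕ).map φ)
    (le_principal_iff.2 (mem_map.2
      (Eventually.of_forall fun n => mem_closedBall_zero_iff.2 (hbd n))))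
  have hlim : Tendsto φ (hyperfilter ℕ : Filter ℕ) (𝓝 ψ) := hψ
  have hU : (hyperfilter ℕ : Filter ℕ) ≤ atTop := by
    rw [← Nat.cofinite_eq_atTop]; exact hyperfilter_le_cofinite
  refine ⟨ψ, ?_, ⟨K, fun j => ?_⟩, ?_⟩
  · have hcl : IsClosed (Ee x : Set (V x)) := Submodule.closed_of_finiteDimensional _
    exact hcl.mem_of_tendsto (tendsto_const_nhds.sub hlim) (Eventually.of_forall hφ)
  · refine le_of_tendsto (((iterMap h D j x).continuous.norm.tendsto ψ).comp hlim) ?_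
    filter_upwards [hU (eventually_ge_atTop j)] with n hn
    exact ((hback n).2 j hn).trans (hbd n)
  · exact (isClosed_coneAround _ _ _).mem_of_tendsto hlim
      (Eventually.of_forall fun n => (hback n).1)

theorem isCompl_boundedOrbits (H : ConeSystem h D N Ec Ee A m) {x : X} (hx : x ∈ N) :
    IsCompl (boundedOrbits h D x) (Ee x) := by
  constructor
  · rw [Submodule.disjoint_def]
    intro v hv hve
    exact H.eq_zero_of_mem_boundedOrbits hx
      (mem_coneAround_of_mem (H.isCompl x hx).symm (H.width_pos x hx).le hve) hv
  · rw [codisjoint_iff, Submodule.eq_top_iff']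
    intro v
    obtain ⟨φ, h1, h2, -⟩ := H.exists_mem_boundedOrbits hx v
    exact Submodule.mem_sup.2 ⟨φ, h2, v - φ, h1, by abel⟩

/-- The vector `φ` constructed from `v` lies in the cone, and `v - φ` is a vector of `Ee x` with
bounded orbit, hence zero. -/
theorem mem_coneAround_of_mem_boundedOrbits (H : ConeSystem h D N Ec Ee A m) {x : X} (hx : x ∈ N)
    {v : V x} (hv : v ∈ boundedOrbits h D x) : v ∈ coneAround (Ec x) (Ee x) (A x) := by
  obtain ⟨φ, h1, h2, h3⟩ := H.exists_mem_boundedOrbits hx v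
  have h4 : v - φ = 0 := Submodule.disjoint_def.1 (H.isCompl_boundedOrbits hx).disjoint _
    (Submodule.sub_mem _ hv h2) h1
  rwa [sub_eq_zero.1 h4]

end ConeSystem

end ConeFields

/-! ### Hyperbolicity of a perturbation that preserves the cones. -/

section Perturbation

variable {E : Type*} [NormedAddCommGroup E] [NormedSpace ℝ E] [FiniteDimensional ℝ E]
  {M : Type*} [MetricSpace M] [ChartedSpace E M] [IsManifold 𝓘(ℝ, E) ∞ M]
  [RiemannianBundle (fun x : M => TangentSpace 𝓘(ℝ, E) x)]
  [IsContMDiffRiemannianBundle 𝓘(ℝ, E) ∞ E (fun x : M => TangentSpace 𝓘(ℝ, E) x)]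
  {f g : M ≃ₘ^1⟮𝓘(ℝ, E), 𝓘(ℝ, E)⟯ M} {N : Set M}
  {Es Eu : (x : M) → Submodule ℝ (TangentSpace 𝓘(ℝ, E) x)} {A : M → ℝ}

/-- Fibrewise scalar multiplication in the tangent bundle. -/
noncomputable def tsmul (c : ℝ) (p : TangentBundle 𝓘(ℝ, E) M) : TangentBundle 𝓘(ℝ, E) M := ⟨p.1, c • p.2⟩

theorem tnorm_tsmul {c : ℝ} (hc : 0 ≤ c) (p : TangentBundle 𝓘(ℝ, E) M) :
    tnorm (tsmul c p) = c * tnorm p := by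
  refine (norm_smul c p.2).trans ?_
  rw [Real.norm_of_nonneg hc]
  rfl

theorem tproj_tsmul (S T : (x : M) → Submodule ℝ (TangentSpace 𝓘(ℝ, E) x)) (c : ℝ)
    (p : TangentBundle 𝓘(ℝ, E) M) : tproj S T (tsmul c p) = tsmul c (tproj S T p) := by
  unfold tproj tsmul
  rw [map_smul]

theorem tangentMap_tsmul (g : M → M) (c : ℝ) (p : TangentBundle 𝓘(ℝ, E) M) :
    tangentMap 𝓘(ℝ, E) 𝓘(ℝ, E) g (tsmul c p) = tsmul c (tangentMap 𝓘(ℝ, E) 𝓘(ℝ, E) g p) := by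
  unfold tangentMap tsmul
  rw [map_smul]

/-- The derivative of `g` preserves the cone fields of width `A` around the splitting, and
expands as much as `f` up to a square root. -/
structure PreservesCones (f g : M ≃ₘ^1⟮𝓘(ℝ, E), 𝓘(ℝ, E)⟯ M) (N : Set M)
    (Es Eu : (x : M) → Submodule ℝ (TangentSpace 𝓘(ℝ, E) x)) (A : M → ℝ) : Prop where
  mapsTo : ∀ x ∈ N, g x ∈ N
  mapsTo_symm : ∀ x ∈ N, g.symm x ∈ N
  forward : ∀ p : TangentBundle 𝓘(ℝ, E) M, p.1 ∈ N →
    tnorm (tproj Es Eu p) ≤ A p.1 * tnorm (tproj Eu Es p) →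
    tnorm (tproj Es Eu (tangentMap 𝓘(ℝ, E) 𝓘(ℝ, E) g p)) ≤
        A (g p.1) * tnorm (tproj Eu Es (tangentMap 𝓘(ℝ, E) 𝓘(ℝ, E) g p)) ∧
      minOn f Eu p.1 * tnorm p ^ 2 ≤ tnorm (tangentMap 𝓘(ℝ, E) 𝓘(ℝ, E) g p) ^ 2
  backward : ∀ p : TangentBundle 𝓘(ℝ, E) M, p.1 ∈ N →
    tnorm (tproj Eu Es (tangentMap 𝓘(ℝ, E) 𝓘(ℝ, E) g p)) ≤
      A (g p.1) * tnorm (tproj Es Eu (tangentMap 𝓘(ℝ, E) 𝓘(ℝ, E) g p)) →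
    tnorm (tproj Eu Es p) ≤ A p.1 * tnorm (tproj Es Eu p) ∧
      minOn f.symm Es (g p.1) * tnorm (tangentMap 𝓘(ℝ, E) 𝓘(ℝ, E) g p) ^ 2 ≤ tnorm p ^ 2

theorem PreservesCones.symm (P : PreservesCones f g N Es Eu A) :
    PreservesCones f.symm g.symm N Eu Es A where
  mapsTo := P.mapsTo_symm
  mapsTo_symm := P.mapsTo
  forward p hp hc := by
    have h1 := P.backward (tangentMap 𝓘(ℝ, E) 𝓘(ℝ, E) g.symm p) (P.mapsTo_symm _ hp)
    have h2 : g (tangentMap 𝓘(ℝ, E) 𝓘(ℝ, E) g.symm p).1 = p.1 := g.apply_symm_apply p.1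
    rw [tangentMap_tangentMap_symm, h2] at h1
    exact h1 hc
  backward p hp hc := by
    have h1 := P.forward (tangentMap 𝓘(ℝ, E) 𝓘(ℝ, E) g.symm p) (P.mapsTo_symm _ hp)
    have h2 : g (tangentMap 𝓘(ℝ, E) 𝓘(ℝ, E) g.symm p).1 = p.1 := g.apply_symm_apply p.1
    rw [tangentMap_tangentMap_symm, h2] at h1
    exact h1 hc

theorem mul_sq_le_of_mul_lt {a b m n X : ℝ} (hn : 0 ≤ n) (hX : m * n ≤ X)
    (h : 0 < b ^ 2 * n - X * a ^ 2) : m * a ^ 2 ≤ b ^ 2 := by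
  rcases hn.eq_or_lt with h0 | h0
  · rw [← h0] at h hX
    nlinarith [sq_nonneg a]
  · refine le_of_mul_le_mul_right ?_ h0
    nlinarith [sq_nonneg a]

/-- All conditions are homogeneous, so unit vectors suffice; the zero vector satisfies them
trivially. -/
theorem PreservesCones.of_coneGap_pos (h : HyperbolicSystem f N Es Eu)
    (hg : ∀ x ∈ N, g x ∈ N) (hg' : ∀ x ∈ N, g.symm x ∈ N)
    (hgap : ∀ p : TangentBundle 𝓘(ℝ, E) M, p.1 ∈ N → tnorm p = 1 →
      0 < coneGap f Es Eu A p (tangentMap 𝓘(ℝ, E) 𝓘(ℝ, E) g p)) :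
    PreservesCones f g N Es Eu A := by
  have hscale : ∀ p : TangentBundle 𝓘(ℝ, E) M, tnorm p ≠ 0 →
      ∃ c > 0, tnorm (tsmul c p) = 1 := by
    intro p hp
    have hp0 : 0 < tnorm p := lt_of_le_of_ne (tnorm_nonneg p) hp.symm
    refine ⟨(tnorm p)⁻¹, inv_pos.2 hp0, ?_⟩
    rw [tnorm_tsmul (inv_pos.2 hp0).le, inv_mul_cancel₀ hp]
  have hzero : ∀ p : TangentBundle 𝓘(ℝ, E) M, tnorm p = 0 →
      p = tsmul 0 p := by
    intro p hp
    have h1 : p.2 = 0 := norm_eq_zero.1 hp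
    unfold tsmul
    rw [zero_smul, ← h1]
  refine ⟨hg, hg', fun p hp hc => ?_, fun p hp hc => ?_⟩
  · rcases eq_or_ne (tnorm p) 0 with h0 | h0
    · rw [hzero p h0, tangentMap_tsmul, tproj_tsmul, tproj_tsmul, tnorm_tsmul le_rfl,
        tnorm_tsmul le_rfl, tnorm_tsmul le_rfl, tnorm_tsmul le_rfl]
      simp
    · obtain ⟨c, hc0, hc1⟩ := hscale p h0
      have h1 := (lt_min_iff.1 (hgap (tsmul c p) hp hc1)).1
      simp only [tangentMap_tsmul, tproj_tsmul, tnorm_tsmul hc0.le] at h1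
      rcases lt_max_iff.1 h1 with h2 | h2
      · exfalso
        change 0 < c * tnorm (tproj Es Eu p) - A p.1 * (c * tnorm (tproj Eu Es p)) at h2
        nlinarith
      · obtain ⟨h3, h4⟩ := lt_min_iff.1 h2
        change 0 < A (g p.1) * (c * _) - c * _ at h3
        constructor
        · refine le_of_mul_le_mul_left ?_ hc0
          linarith
        · have h5 := mul_sq_le_of_mul_lt (m := minOn f Eu p.1)
            (mul_nonneg hc0.le (tnorm_nonneg (tproj Eu Es p))) (by
              have := h.expand_u (p := tproj Eu Es p) (projAlong_mem _ _ _)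
              calc minOn f Eu p.1 * (c * tnorm (tproj Eu Es p))
                  = c * (minOn f Eu p.1 * tnorm (tproj Eu Es p)) := by ring
                _ ≤ _ := mul_le_mul_of_nonneg_left this hc0.le) h4
          refine le_of_mul_le_mul_left ?_ (pow_pos hc0 2)
          linarith
  · rcases eq_or_ne (tnorm p) 0 with h0 | h0
    · rw [hzero p h0, tangentMap_tsmul, tproj_tsmul, tproj_tsmul, tnorm_tsmul le_rfl,
        tnorm_tsmul le_rfl, tnorm_tsmul le_rfl, tnorm_tsmul le_rfl]
      simp
    · obtain ⟨c, hc0, hc1⟩ := hscale p h0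
      have h1 := (lt_min_iff.1 (hgap (tsmul c p) hp hc1)).2
      simp only [tangentMap_tsmul, tproj_tsmul, tnorm_tsmul hc0.le] at h1
      rcases lt_max_iff.1 h1 with h2 | h2
      · exfalso
        change 0 < c * _ - A (g p.1) * (c * _) at h2
        nlinarith
      · obtain ⟨h3, h4⟩ := lt_min_iff.1 h2
        change 0 < A p.1 * (c * _) - c * _ at h3
        constructor
        · refine le_of_mul_le_mul_left ?_ hc0
          linarith
        · have h5 := mul_sq_le_of_mul_lt (m := minOn f.symm Es (g p.1))
            (mul_nonneg hc0.le (tnorm_nonneg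
              (tproj Es Eu (tangentMap 𝓘(ℝ, E) 𝓘(ℝ, E) g p)))) (by
              have := h.symm.expand_u (p := tproj Es Eu (tangentMap 𝓘(ℝ, E) 𝓘(ℝ, E) g p))
                (projAlong_mem _ _ _)
              calc minOn f.symm Es (g p.1) * (c * tnorm _)
                  = c * (minOn f.symm Es (g p.1) *
                    tnorm (tproj Es Eu (tangentMap 𝓘(ℝ, E) 𝓘(ℝ, E) g p))) := by ring
                _ ≤ _ := mul_le_mul_of_nonneg_left this hc0.le) h4
          refine le_of_mul_le_mul_left ?_ (pow_pos hc0 2)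
          linarith

instance finiteDimensional_tangentSpace (x : M) : FiniteDimensional ℝ (TangentSpace 𝓘(ℝ, E) x) :=
  inferInstanceAs (FiniteDimensional ℝ E)

theorem PreservesCones.coneSystem (P : PreservesCones f g N Es Eu A)
    (h : HyperbolicSystem f N Es Eu) (hA : ConeWidth f N Es Eu A) (hN : IsPreconnected N)
    (hprod : ∀ x ∈ N, ProdDiverges fun i => minOn f Eu (g^[i] x)) :
    ConeSystem (V := fun x : M => TangentSpace 𝓘(ℝ, E) x) g
      (fun x => mfderiv 𝓘(ℝ, E) 𝓘(ℝ, E) g x) N Es Eu A (fun x => minOn f Eu x) where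
  mapsTo := P.mapsTo
  isCompl := h.isCompl
  finrank_fiber _ _ _ _ := rfl
  finrank_eq _ hx _ hy := h.finrank_eq hN hx hy
  width_pos := hA.pos
  width_lt_one := hA.lt_one
  one_le x hx := (h.one_lt_u x hx).le
  prod := hprod
  forward x hx v hv := P.forward ⟨x, v⟩ hx hv
  backward x hx v hv := by
    obtain ⟨h1, h2⟩ := P.backward ⟨x, v⟩ hx hv
    refine ⟨h1, ?_⟩
    have h3 := (h.one_lt_s _ (P.mapsTo x hx)).le
    refine le_of_sq_le_sq ?_ (norm_nonneg v)
    exact (le_mul_of_one_le_left (sq_nonneg _) h3).trans h2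

theorem restrNorm_le {V W : Type*} [NormedAddCommGroup V] [NormedSpace ℝ V]
    [NormedAddCommGroup W] [NormedSpace ℝ W] (B : V →L[ℝ] W) (S : Submodule ℝ V) {c : ℝ}
    (hc : 0 ≤ c) (h : ∀ v ∈ S, ‖B v‖ ≤ c * ‖v‖) : restrNorm B S ≤ c :=
  ContinuousLinearMap.opNorm_le_bound _ hc fun v => h v v.2

theorem le_restrNorm {V W : Type*} [NormedAddCommGroup V] [NormedSpace ℝ V]
    [NormedAddCommGroup W] [NormedSpace ℝ W] (B : V →L[ℝ] W) (S : Submodule ℝ V) {v : V}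
    (hv : v ∈ S) : ‖B v‖ ≤ restrNorm B S * ‖v‖ :=
  (B ∘L S.subtypeL).le_opNorm ⟨v, hv⟩

theorem mfderiv_surjective (g : M ≃ₘ^1⟮𝓘(ℝ, E), 𝓘(ℝ, E)⟯ M) (x : M) :
    Function.Surjective (mfderiv 𝓘(ℝ, E) 𝓘(ℝ, E) g x) :=
  (g.mfderivToContinuousLinearEquiv one_ne_zero x).surjective

theorem PreservesCones.pointwiseHyperbolic (P : PreservesCones f g N Es Eu A)
    (h : HyperbolicSystem f N Es Eu) (hA : ConeWidth f N Es Eu A) (hN : IsPreconnected N)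
    (hprod_u : ∀ x ∈ N, ProdDiverges fun i => minOn f Eu (g^[i] x))
    (hprod_s : ∀ x ∈ N, ProdDiverges fun i => minOn f.symm Es (g.symm^[i] x)) :
    PointwiseHyperbolic E g N := by
  have Hs := P.coneSystem h hA hN hprod_u
  have Hu := P.symm.coneSystem h.symm (hA.symm h) hN hprod_s
  set Fs : (x : M) → Submodule ℝ (TangentSpace 𝓘(ℝ, E) x) :=
    boundedOrbits (V := fun x : M => TangentSpace 𝓘(ℝ, E) x) g
      (fun x => mfderiv 𝓘(ℝ, E) 𝓘(ℝ, E) g x) with hFs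
  set Fu : (x : M) → Submodule ℝ (TangentSpace 𝓘(ℝ, E) x) :=
    boundedOrbits (V := fun x : M => TangentSpace 𝓘(ℝ, E) x) g.symm
      (fun x => mfderiv 𝓘(ℝ, E) 𝓘(ℝ, E) g.symm x) with hFu
  have hFs_iff : ∀ p : TangentBundle 𝓘(ℝ, E) M,
      (tangentMap 𝓘(ℝ, E) 𝓘(ℝ, E) g p).2 ∈ Fs (tangentMap 𝓘(ℝ, E) 𝓘(ℝ, E) g p).1 ↔
        p.2 ∈ Fs p.1 := fun p => map_mem_boundedOrbits
  have hFu_iff : ∀ p : TangentBundle 𝓘(ℝ, E) M,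
      (tangentMap 𝓘(ℝ, E) 𝓘(ℝ, E) g p).2 ∈ Fu (tangentMap 𝓘(ℝ, E) 𝓘(ℝ, E) g p).1 ↔
        p.2 ∈ Fu p.1 := by
    intro p
    have h1 : (tangentMap 𝓘(ℝ, E) 𝓘(ℝ, E) g.symm (tangentMap 𝓘(ℝ, E) 𝓘(ℝ, E) g p)).2 ∈
        Fu (tangentMap 𝓘(ℝ, E) 𝓘(ℝ, E) g.symm (tangentMap 𝓘(ℝ, E) 𝓘(ℝ, E) g p)).1 ↔
        (tangentMap 𝓘(ℝ, E) 𝓘(ℝ, E) g p).2 ∈ Fu (tangentMap 𝓘(ℝ, E) 𝓘(ℝ, E) g p).1 :=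
      map_mem_boundedOrbits
    rw [tangentMap_symm_tangentMap] at h1
    exact h1.symm
  have hdim_s : ∀ x ∈ N, Module.finrank ℝ (Fs x) = Module.finrank ℝ (Es x) := by
    intro x hx
    have h1 := Submodule.finrank_add_eq_of_isCompl (Hs.isCompl_boundedOrbits hx)
    have h2 := Submodule.finrank_add_eq_of_isCompl (h.isCompl x hx)
    exact Nat.add_right_cancel (h1.trans h2.symm)
  have hdim_u : ∀ x ∈ N, Module.finrank ℝ (Fu x) = Module.finrank ℝ (Eu x) := by
    intro x hx
    have h1 := Submodule.finrank_add_eq_of_isCompl (Hu.isCompl_boundedOrbits hx)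
    have h2 := Submodule.finrank_add_eq_of_isCompl (h.isCompl x hx).symm
    exact Nat.add_right_cancel (h1.trans h2.symm)
  have hmap : ∀ F : (x : M) → Submodule ℝ (TangentSpace 𝓘(ℝ, E) x),
      (∀ p : TangentBundle 𝓘(ℝ, E) M,
        (tangentMap 𝓘(ℝ, E) 𝓘(ℝ, E) g p).2 ∈ F (tangentMap 𝓘(ℝ, E) 𝓘(ℝ, E) g p).1 ↔
          p.2 ∈ F p.1) →
      ∀ x, (F x).map (mfderiv 𝓘(ℝ, E) 𝓘(ℝ, E) g x).toLinearMap = F (g x) := by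
    intro F hF x
    ext w
    constructor
    · rintro ⟨v, hv, rfl⟩
      exact (hF ⟨x, v⟩).2 hv
    · intro hw
      obtain ⟨v, rfl⟩ := mfderiv_surjective g x w
      exact ⟨v, (hF ⟨x, v⟩).1 hw, rfl⟩
  -- The cones control squared norms by the rates of `f`, so the rates of `g` are square roots. The
  -- one for `Fs` is taken at `g x`, where the contraction of `f` is expressed through its inverse.
  refine ⟨Fs, Fu, ?_, ?_, fun x _ => hmap Fs hFs_iff x, fun x _ => hmap Fu hFu_iff x,
    fun x => (√(minOn f.symm Es (g x)))⁻¹, fun x => √(minOn f Eu x), ?_⟩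
  · refine Subset.antisymm ?_ fun x hx => ⟨g.symm x, P.mapsTo_symm x hx, g.apply_symm_apply x⟩
    rintro _ ⟨x, hx, rfl⟩
    exact P.mapsTo x hx
  · intro x hx
    have hdisj : Disjoint (Fs x) (Fu x) := by
      rw [Submodule.disjoint_def]
      intro v hs hu
      exact eq_zero_of_mem_coneAround (h.isCompl x hx) (hA.pos x hx).le (hA.lt_one x hx)
        (Hs.mem_coneAround_of_mem_boundedOrbits hx hs)
        (Hu.mem_coneAround_of_mem_boundedOrbits hx hu)
    refine ⟨hdisj, codisjoint_iff.2 (Submodule.eq_top_of_disjoint _ _ ?_ hdisj)⟩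
    rw [hdim_s x hx, hdim_u x hx]
    exact (Submodule.finrank_add_eq_of_isCompl (h.isCompl x hx)).ge
  · intro x hx
    have hms := h.one_lt_s _ (P.mapsTo x hx)
    have hmu := h.one_lt_u _ hx
    have hs1 : 1 < √(minOn f.symm Es (g x)) := by
      rw [Real.lt_sqrt zero_le_one]; simpa using hms
    have hu1 : 1 < √(minOn f Eu x) := by
      rw [Real.lt_sqrt zero_le_one]; simpa using hmu
    have hspos := zero_lt_one.trans hs1
    refine ⟨inv_pos.2 hspos, ?_, inv_lt_one_of_one_lt₀ hs1, hu1, ?_⟩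
    · refine restrNorm_le _ _ (inv_pos.2 hspos).le fun v hv => ?_
      have h1 := Hs.mem_coneAround_of_mem_boundedOrbits (P.mapsTo x hx) ((hFs_iff ⟨x, v⟩).2 hv)
      have h2 := (P.backward ⟨x, v⟩ hx h1).2
      change minOn f.symm Es (g x) * ‖mfderiv 𝓘(ℝ, E) 𝓘(ℝ, E) g x v‖ ^ 2 ≤ ‖v‖ ^ 2 at h2
      rw [inv_mul_eq_div, le_div_iff₀ hspos]
      refine le_of_sq_le_sq ?_ (norm_nonneg v)
      rwa [mul_pow, Real.sq_sqrt (by linarith), mul_comm]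
    · refine le_minNorm _ _ ?_ fun v hv => ?_
      · intro h0
        have h1 := hdim_u x hx
        rw [h0, finrank_bot] at h1
        exact h.ne_bot hx (Submodule.finrank_eq_zero.1 h1.symm)
      · have h1 := Hu.mem_coneAround_of_mem_boundedOrbits hx hv
        have h2 := (P.forward ⟨x, v⟩ hx h1).2
        change minOn f Eu x * ‖v‖ ^ 2 ≤ ‖mfderiv 𝓘(ℝ, E) 𝓘(ℝ, E) g x v‖ ^ 2 at h2
        refine le_of_sq_le_sq ?_ (norm_nonneg _)
        rwa [mul_pow, Real.sq_sqrt (by linarith)]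

theorem HyperbolicSystem.of_splitting (hhyp : IsHyperbolicSplitting f N Es Eu)
    (hu : ∀ x ∈ N, ProdDiverges fun i => minOn f Eu (f^[i] x))
    (hs : ∀ x ∈ N, ProdDiverges fun i => minOn f.symm Es (f.symm^[i] x)) :
    HyperbolicSystem f N Es Eu := by
  obtain ⟨hN, hcompl, hEs, hEu, τs, τu, hτ⟩ := hhyp
  have hmaps : ∀ x ∈ N, f x ∈ N := fun x hx => hN ▸ mem_image_of_mem f hx
  have hmaps' : ∀ x ∈ N, f.symm x ∈ N := by
    intro x hx
    rw [← hN] at hx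
    obtain ⟨y, hy, rfl⟩ := hx
    rwa [show f.symm (f y) = y from f.symm_apply_apply y]
  have hmem : ∀ F : (x : M) → Submodule ℝ (TangentSpace 𝓘(ℝ, E) x),
      (∀ x ∈ N, (F x).map (mfderiv 𝓘(ℝ, E) 𝓘(ℝ, E) f x).toLinearMap = F (f x)) →
      ∀ p : TangentBundle 𝓘(ℝ, E) M, p.1 ∈ N → p.2 ∈ F p.1 →
        (tangentMap 𝓘(ℝ, E) 𝓘(ℝ, E) f p).2 ∈ F (tangentMap 𝓘(ℝ, E) 𝓘(ℝ, E) f p).1 := by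
    intro F hF p hp hpF
    exact (hF p.1 hp).le ⟨p.2, hpF, rfl⟩
  have hmem' : ∀ F : (x : M) → Submodule ℝ (TangentSpace 𝓘(ℝ, E) x),
      (∀ x ∈ N, (F x).map (mfderiv 𝓘(ℝ, E) 𝓘(ℝ, E) f x).toLinearMap = F (f x)) →
      ∀ p : TangentBundle 𝓘(ℝ, E) M, p.1 ∈ N → p.2 ∈ F p.1 →
        (tangentMap 𝓘(ℝ, E) 𝓘(ℝ, E) f.symm p).2 ∈
          F (tangentMap 𝓘(ℝ, E) 𝓘(ℝ, E) f.symm p).1 := by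
    rintro F hF ⟨x, v⟩ hp hpF
    obtain ⟨y, hy, rfl⟩ : x ∈ f '' N := by rw [hN]; exact hp
    obtain ⟨w, hw, rfl⟩ := (hF y hy).ge hpF
    have h1 := tangentMap_symm_tangentMap f ⟨y, w⟩
    change tangentMap 𝓘(ℝ, E) 𝓘(ℝ, E) f.symm ⟨f y, mfderiv 𝓘(ℝ, E) 𝓘(ℝ, E) f y w⟩ = _ at h1
    change (tangentMap 𝓘(ℝ, E) 𝓘(ℝ, E) f.symm ⟨f y, mfderiv 𝓘(ℝ, E) 𝓘(ℝ, E) f y w⟩).2 ∈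
      F (tangentMap 𝓘(ℝ, E) 𝓘(ℝ, E) f.symm ⟨f y, mfderiv 𝓘(ℝ, E) 𝓘(ℝ, E) f y w⟩).1
    rw [h1]
    exact hw
  refine ⟨hmaps, hmaps', hcompl, hmem Es hEs, hmem Eu hEu, hmem' Es hEs, hmem' Eu hEu, ?_, ?_,
    hu, hs⟩
  · intro x hx
    obtain ⟨-, -, -, h1, h2⟩ := hτ x hx
    exact h1.trans_le h2
  · intro x hx
    obtain ⟨h1, h2, h3, -, -⟩ := hτ _ (hmaps' x hx)
    refine lt_of_lt_of_le ((one_lt_inv₀ h1).2 h3) (le_minNorm _ _ ?_ fun v hv => ?_)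
    · intro h0
      -- On a zero subspace the minimum norm is 0, and a product with a zero factor cannot diverge;
      -- this excludes `Es x = ⊥`.
      refine (hs x hx).ne_zero 0 ?_
      have hbot : minOn f.symm Es x = 0 := by rw [minOn, h0, minNorm_bot]
      exact hbot
    · have h4 := tangentMap_tangentMap_symm f ⟨x, v⟩
      have h5 := hmem' Es hEs ⟨x, v⟩ hx hv
      have h6 := le_restrNorm (mfderiv 𝓘(ℝ, E) 𝓘(ℝ, E) f (f.symm x)) (Es (f.symm x)) h5
      change tnorm (tangentMap 𝓘(ℝ, E) 𝓘(ℝ, E) f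
        (tangentMap 𝓘(ℝ, E) 𝓘(ℝ, E) f.symm ⟨x, v⟩)) ≤ _ at h6
      rw [h4] at h6
      rw [inv_mul_le_iff₀ h1]
      exact h6.trans (mul_le_mul_of_nonneg_right h2 (norm_nonneg _))

/-- The tolerance tends to zero at the boundary, so `g = f` there and no boundary point is mapped
into `N`. Hence `g '' N` is open and relatively closed in the connected set `N`. -/
theorem mapsTo_symm_of_dist_lt (hN : IsOpen N) (hNc : IsConnected N)
    (hf : ∀ x ∈ N, f.symm x ∈ N) {ξ : M → ℝ} (hξ : ∀ x ∈ N, Metric.ball (f x) (ξ x) ⊆ N)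
    (hg : ∀ x ∈ N, dist (f x) (g x) < ξ x) : ∀ x ∈ N, g.symm x ∈ N := by
  have hgN : ∀ x ∈ N, g x ∈ N := fun x hx =>
    hξ x hx (Metric.mem_ball.2 (by rw [dist_comm]; exact hg x hx))
  have hfc := f.contMDiff.continuous
  have hgc := g.contMDiff.continuous
  have heq : ∀ x ∈ closure N, x ∉ N → g x = f x ∧ f x ∉ N := by
    intro x hx hxN
    have hfx : f x ∉ N := by
      intro h1
      have h2 := hf _ h1
      rw [show f.symm (f x) = x from f.symm_apply_apply x] at h2
      exact hxN h2
    refine ⟨?_, hfx⟩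
    have : (𝓝[N] x).NeBot := mem_closure_iff_nhdsWithin_neBot.1 hx
    have h1 : Tendsto (fun y => dist (f y) (g y)) (𝓝[N] x) (𝓝 (dist (f x) (g x))) :=
      ((hfc.dist hgc).tendsto x).mono_left nhdsWithin_le_nhds
    have h2 : Tendsto (fun y => dist (f x) (f y)) (𝓝[N] x) (𝓝 (dist (f x) (f x))) :=
      ((continuous_const.dist hfc).tendsto x).mono_left nhdsWithin_le_nhds
    have h3 : dist (f x) (g x) ≤ dist (f x) (f x) := by
      refine le_of_tendsto_of_tendsto h1 h2 ?_
      filter_upwards [self_mem_nhdsWithin] with y hy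
      -- The ball of radius `ξ y` about `f y` lies in `N`, hence misses `f x`.
      have h4 : ξ y ≤ dist (f x) (f y) := by
        by_contra hcon
        exact hfx (hξ y hy (Metric.mem_ball.2 (not_le.1 hcon)))
      exact (hg y hy).le.trans h4
    rw [dist_self] at h3
    exact (dist_le_zero.1 h3).symm
  have hopen : IsOpen (g '' N) := g.toHomeomorph.isOpenMap _ hN
  have hsub : N ⊆ g '' N := by
    refine hNc.isPreconnected.subset_of_closure_inter_subset hopen ?_ ?_
    · obtain ⟨x, hx⟩ := hNc.nonempty
      exact ⟨g x, hgN x hx, mem_image_of_mem g hx⟩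
    · rintro y ⟨hy, hyN⟩
      have h1 : closure (g '' N) = g '' closure N := (g.toHomeomorph.image_closure N).symm
      rw [h1] at hy
      obtain ⟨x, hx, rfl⟩ := hy
      by_cases hxN : x ∈ N
      · exact mem_image_of_mem g hxN
      · obtain ⟨h2, h3⟩ := heq x hx hxN
        rw [h2] at hyN
        exact absurd hyN h3
  intro x hx
  obtain ⟨y, hy, rfl⟩ := hsub hx
  rwa [show g.symm (g y) = y from g.symm_apply_apply y]

variable {q : ℕ} {ι : M → EuclideanSpace ℝ (Fin q)}

theorem norm_euclDeriv_sub_le (hι : ContMDiff 𝓘(ℝ, E) 𝓘(ℝ, EuclideanSpace ℝ (Fin q)) ∞ ι)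
    (f g : M ≃ₘ^1⟮𝓘(ℝ, E), 𝓘(ℝ, E)⟯ M) (p : TangentBundle 𝓘(ℝ, E) M) :
    ‖euclDeriv ι (tangentMap 𝓘(ℝ, E) 𝓘(ℝ, E) f p) -
      euclDeriv ι (tangentMap 𝓘(ℝ, E) 𝓘(ℝ, E) g p)‖ ≤ derivDist E ι f g p.1 * tnorm p := by
  have hcomp : ∀ g : M ≃ₘ^1⟮𝓘(ℝ, E), 𝓘(ℝ, E)⟯ M,
      ambientDeriv (E := E) ι g p.1 p.2 = euclDeriv ι (tangentMap 𝓘(ℝ, E) 𝓘(ℝ, E) g p) := by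
    intro g
    unfold ambientDeriv
    rw [mfderiv_comp p.1 (hι.mdifferentiable (by simp) _)
      (g.contMDiff.mdifferentiable one_ne_zero p.1)]
    rfl
  rw [← hcomp f, ← hcomp g]
  exact (ambientDeriv (E := E) ι f p.1 - ambientDeriv (E := E) ι g p.1).le_opNorm p.2

end Perturbation

/-! ### Bounds for the scales and the main theorem. -/

theorem truncPow_nonneg {M : Type*} [MetricSpace M] (N : Set M) (r p : ℝ) (x : M) :
    0 ≤ truncPow N r p x := ENNReal.toReal_nonneg

theorem truncPow_le {M : Type*} [MetricSpace M] (N : Set M) {r : ℝ} (hr : 0 < r) (p : ℝ) (x : M) :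
    truncPow N r p x ≤ r ^ p := by
  refine ENNReal.toReal_le_of_le_ofReal (Real.rpow_nonneg hr.le p) ?_
  rw [← ENNReal.ofReal_rpow_of_pos hr]
  exact min_le_left _ _

end PointwiseHyp

open PointwiseHyp
theorem mainTheorem5
    {E : Type*} [NormedAddCommGroup E] [NormedSpace ℝ E] [FiniteDimensional ℝ E]
    {M : Type*} [MetricSpace M] [CompactSpace M] [ConnectedSpace M]
    [ChartedSpace E M] [IsManifold 𝓘(ℝ, E) ∞ M]
    [RiemannianBundle (fun x : M => TangentSpace 𝓘(ℝ, E) x)]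
    [IsContMDiffRiemannianBundle 𝓘(ℝ, E) ∞ E (fun x : M => TangentSpace 𝓘(ℝ, E) x)]
    [IsRiemannianManifold 𝓘(ℝ, E) M]
    {q : ℕ} (ι : M → EuclideanSpace ℝ (Fin q)) (hι : IsEuclideanEmbedding E ι)
    (N : Set M) (hN_open : IsOpen N) (hN_conn : IsConnected N)
    (α : ℝ) (hα₀ : 0 < α) (hα₁ : α ≤ 1)
    (f : M ≃ₘ^1⟮𝓘(ℝ, E), 𝓘(ℝ, E)⟯ M) (hf : IsC1Holder (E := E) α f)
    (Es Eu : (x : M) → Submodule ℝ (TangentSpace 𝓘(ℝ, E) x))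
    (hhyp : IsHyperbolicSplitting f N Es Eu)
    (cu cs : RateConsts)
    (hU : AssumptionU f N Eu α cu) (hS : AssumptionS f N Es α cs)
    (hR : AssumptionR α cu cs) (hK : AssumptionK f N Es Eu cu cs)
    (δ : ℝ) (hδ₀ : 0 < δ) (hδ₁ : δ < min 1 (α - betaMax cu cs / gammaMin cu cs)) :
    ∃ ξ : M → ℝ, ContinuousOn ξ N ∧ (∀ x ∈ N, 0 < ξ x) ∧
      ∃ ε₁ : ℝ, 0 < ε₁ ∧ ∀ ε : ℝ, 0 < ε → ε < ε₁ →
        ∀ δu : M → ℝ, (∀ x ∈ N, 0 < δu x ∧ δu x < ε * epsFun N cu cs ε x) →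
          ∀ g : M ≃ₘ^1⟮𝓘(ℝ, E), 𝓘(ℝ, E)⟯ M,
            (∀ x ∈ N,
              ProdDiverges (fun i => minOn f Eu (g^[i] x)) ∧
              ProdDiverges (fun i => minOn f.symm Es (g.symm^[i] x))) →
            (∀ x ∈ N,
              max (dist (f x) (g x)) (derivDist E ι f g x)
                < ξ x * δu x * Q N cu cs α δ ε x ^ 2 * Q N cu cs α δ ε (f x)) →
            PointwiseHyperbolic E g N := by
  have h : HyperbolicSystem f N Es Eu :=
    .of_splitting hhyp (fun x hx => (hU.1 x hx).1) (fun x hx => (hS.1 x hx).2)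
  obtain ⟨A, hA⟩ := h.exists_coneWidth hN_open hα₁ hU.2.1 hS.2.1 hR hU.2.2 hS.2.2
  obtain ⟨ξ, hξc, hξ⟩ := exists_continuous_tolerance (f := f) hι hN_open h.mapsTo
    (G := coneGap f Es Eu A)
    (fun p hp => continuousAt_coneGap hA h hN_open hp (h.mapsTo _ hp))
    (fun p hp hp1 => coneGap_pos hA h hp (by rw [hp1]; exact one_ne_zero))
  set r := rMin cu cs with hr_def
  set β := betaMax cu cs with hβ_def
  set γ := gammaMin cu cs with hγ_def
  have hr : 0 < r := lt_min hU.2.1.1 hS.2.1.1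
  have hrβ : 0 < r ^ β := Real.rpow_pos_of_pos hr β
  have hrγ : 0 < r ^ γ := Real.rpow_pos_of_pos hr γ
  have hγ : 0 < γ := by
    have h1 : 1 < cu.γ := (le_max_left _ _).trans_lt hU.2.1.2.2.1
    have h2 : 1 < cs.γ := (le_max_left _ _).trans_lt hS.2.1.2.2.1
    exact zero_lt_one.trans (lt_min h2 h1)
  have hβ : 0 < β := lt_max_of_lt_left hS.2.1.2.1
  have hδα : 0 ≤ 2 / (α - δ) := by
    have h1 := hδ₁.trans_le (min_le_right _ _)
    have h2 : 0 < β / γ := div_pos hβ hγ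
    exact div_nonneg zero_le_two (by linarith)
  -- For `ε < 1` the scales satisfy `δu ≤ r ^ β` and `Q ≤ r ^ γ`, so `B` bounds the factor that
  -- multiplies `ξ` in the closeness hypothesis. Dividing the tolerance by `B` makes `ε₁ = 1`
  -- sufficient.
  set B := r ^ β * (r ^ γ) ^ 2 * r ^ γ with hB_def
  have hB : 0 < B := by positivity
  refine ⟨fun x => ξ x / B, hξc.div_const B, fun x hx => div_pos (hξ x hx).1 hB, 1, one_pos, ?_⟩
  intro ε hε hε1 δu hδu g hprod hclose
  have hQ0 : ∀ x, 0 ≤ Q N cu cs α δ ε x := fun x =>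
    mul_nonneg (Real.rpow_nonneg hε.le _) (truncPow_nonneg _ _ _ _)
  have hQ : ∀ x, Q N cu cs α δ ε x ≤ r ^ γ := fun x =>
    (mul_le_of_le_one_left (truncPow_nonneg _ _ _ _)
      (Real.rpow_le_one hε.le hε1.le hδα)).trans (truncPow_le N hr γ x)
  have hδ : ∀ x ∈ N, δu x ≤ r ^ β := by
    intro x hx
    have h1 := truncPow_nonneg N r β x
    have h2 : epsFun N cu cs ε x ≤ truncPow N r β x := mul_le_of_le_one_left h1 hε1.le
    have h3 : 0 ≤ epsFun N cu cs ε x := mul_nonneg hε.le h1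
    exact (hδu x hx).2.le.trans
      ((mul_le_of_le_one_left h3 hε1.le).trans (h2.trans (truncPow_le N hr β x)))
  have hlt : ∀ x ∈ N, max (dist (f x) (g x)) (derivDist E ι f g x) < ξ x := by
    intro x hx
    refine (hclose x hx).trans_le ?_
    have h1 := hQ0 x
    have h2 := hQ0 (f x)
    have h3 := hQ x
    have h4 := hQ (f x)
    have h5 := hδ x hx
    have h6 := (hδu x hx).1
    have h7 := (hξ x hx).1
    calc ξ x / B * δu x * Q N cu cs α δ ε x ^ 2 * Q N cu cs α δ ε (f x)
        ≤ ξ x / B * r ^ β * (r ^ γ) ^ 2 * r ^ γ := by gcongr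
      _ = ξ x / B * B := by rw [hB_def]; ring
      _ = ξ x := div_mul_cancel₀ _ hB.ne'
  have hdist : ∀ x ∈ N, dist (f x) (g x) < ξ x := fun x hx => (le_max_left _ _).trans_lt (hlt x hx)
  have hg : ∀ x ∈ N, g x ∈ N := fun x hx =>
    (hξ x hx).2.1 (Metric.mem_ball.2 (by rw [dist_comm]; exact hdist x hx))
  have hg' := mapsTo_symm_of_dist_lt hN_open hN_conn h.mapsTo_symm
    (fun x hx => (hξ x hx).2.1) hdist
  have P : PreservesCones f g N Es Eu A := by
    refine .of_coneGap_pos h hg hg' fun p hp hp1 => ?_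
    refine (hξ p.1 hp).2.2 p rfl hp1 _ (hdist p.1 hp) ?_
    refine (norm_euclDeriv_sub_le hι.1 f g p).trans_lt ?_
    rw [hp1, mul_one]
    exact (le_max_right _ _).trans_lt (hlt p.1 hp)
  exact P.pointwiseHyperbolic h hA hN_conn.isPreconnected (fun x hx => (hprod x hx).1)
    (fun x hx => (hprod x hx).2)
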